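/- **Theorem 4.1.** A finite graph $\mathcal G$ is a *$(b,d)$-expander* if its maximum degree is $d$ and, for every $S\subset V(\mathcal G)$ with $|S|\le |V(\mathcal G)|/2$, there are at least $b|S|$ edges of $\mathcal G$ between $S$ and $V(\mathcal G)\setminus S$. Write $\mathcal G_p$ for bond percolation on $\mathcal G$: the random spanning subgraph in which each edge of $\mathcal G$ is present independently with probability $p$. A *separator* of a finite graph $G=(V,E)$ is a set $S\subset V$ for which there is a partition $V=A\cup B\cup S$ (parts may be empty) such that $G$ has no edge between $A$ and $B$, and $|A|,|B|\le \tfrac23|V|$. Let $d\ge 3$ be an integer and let $\frac1{d-1}<p<1$. For every $b>0$ there exist $\delta,c_1,R,C>0$, depending only on $d$, $p$ and $b$, such that the following holds for every $n$ and every $d$-regular $(b,d)$-expander $\mathcal G$ on $n$ vertices with girth larger than $R$. With probability at least $1-Ce^{-c_1n}$, the largest connected component of the random graph $G\sim\mathcal G_p$ (each of the largest ones, in case of a tie), viewed as a graph in its own right, has no separator of size at most $\delta n$. -/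

import Mathlib

open MeasureTheory ProbabilityTheory

namespace PercExp

variable {V : Type*}

/-- A `(b, d)`-expander: the maximum degree is `d`, and every set `S` of at most half of the
vertices has at least `b * |S|` edges in the cut between `S` and its complement.
The set `G.interedges S Sᶜ` consists of the pairs `(x, y)` with `x ∈ S`, `y ∉ S` and `x ~ y`,
so it contains each edge of the cut exactly once. -/
def IsExpander [Fintype V] [DecidableEq V] (G : SimpleGraph V) [DecidableRel G.Adj]
    (b : ℝ) (d : ℕ) : Prop :=
  G.maxDegree = d ∧
    ∀ S : Finset V, (S.card : ℝ) ≤ (Fintype.card V : ℝ) / 2 →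
      b * (S.card : ℝ) ≤ ((G.interedges S Sᶜ).card : ℝ)

/-- Bond percolation on `G` with parameter `p`: the law of the random spanning subgraph of `G` in
which each edge of `G` is present, independently, with probability `p`. -/
noncomputable def percolation (G : SimpleGraph V) (p : unitInterval) :
    Measure (SimpleGraph V) :=
  (setBernoulli G.edgeSet p).map SimpleGraph.fromEdgeSet

/-- A connected component with the largest possible number of vertices. -/
def IsLargestComponent (H : SimpleGraph V) (K : H.ConnectedComponent) : Prop :=
  ∀ K' : H.ConnectedComponent, K'.supp.ncard ≤ K.supp.ncard

/-- `S` is a separator of the finite graph `G`: the vertex set is a disjoint union `A ∪ B ∪ S`,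
there is no edge between `A` and `B`, and each of `A`, `B` contains at most two thirds of all
vertices. -/
def IsSeparator (G : SimpleGraph V) (S : Set V) : Prop :=
  ∃ A B : Set V,
    A ∪ B ∪ S = Set.univ ∧ Disjoint A B ∧ Disjoint A S ∧ Disjoint B S ∧
    (∀ x ∈ A, ∀ y ∈ B, ¬ G.Adj x y) ∧
    (A.ncard : ℝ) ≤ 2 * (Nat.card V : ℝ) / 3 ∧ (B.ncard : ℝ) ≤ 2 * (Nat.card V : ℝ) / 3

end PercExp

/-! The proof is by sprinkling. Let θ be the survival probability at the root of the `d`-regular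
tree percolated at density `p`. Some `p₁ < p` still has root survival at least `0.99 θ`, and density
`p` is the union of two independent subsets of densities `p₁` and `q` (`bernExp_union`). Call a
vertex a survivor if an open path of `m` edges leads away from it. Girth above `2 (m + 1)` makes
this a tree event, so the expected number of survivors is `n` times a branching probability, and
bounded differences concentrate it. Up to exponentially small probability, the set `M` of
`p₁`-survivors has at least `0.98 θ n` elements, while the survivors of the union number at most
`1.02 θ n`.

For two fixed disjoint sets of at least `ε n` vertices, expansion gives linearly many edge-disjoint
connections of bounded length; linearly many of them are open at density `q`, so a small open cut
separates the two sets with probability at most `exp (-c n)` (`exists_separation_rate`). A union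
bound over all splittings of `M` would be too costly. However, each `p₁`-survivor has `m + 1`
vertices of its cluster within distance `m`, so a net of at most `n / (m + 1)` vertices controls
`M`: a set with few open boundary edges agrees, on all but few vertices of `M`, with a union of
fibres over the net (`exists_net`, `exists_rounding`). Only `2 ^ (n / (m + 1))` splittings remain.
Since `c` does not depend on `m`, the choice `1 / (m + 1) ≤ c / 2` makes the union bound succeed
(`sprinkling_bound`).

Hence no small open cut splits `M` into two large parts. Grouping clusters then shows that some
cluster has at least `|M| / 3` vertices. The largest cluster is thus too big to contain a
non-survivor, and almost all of it lies in `M`. A separator of size `δ n` would leave a side `A`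
whose open boundary has at most `d δ n` edges although both sides contain much of `M`, a
contradiction (`no_separator_of_no_small_cut`). -/

namespace PercExp

/-! ### Expectations over random subsets, independence and concentration -/

section BernoulliExpectation

variable {α : Type*} [DecidableEq α]

/-- The expectation of `f T`, where `T` is a random subset of `E` containing each element
independently with probability `p`. -/
noncomputable def bernExp (E : Finset α) (p : ℝ) (f : Finset α → ℝ) : ℝ :=
  ∑ T ∈ E.powerset, p ^ T.card * (1 - p) ^ (E \ T).card * f T

theorem bernExp_empty (p : ℝ) (f : Finset α → ℝ) : bernExp ∅ p f = f ∅ := by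
  simp [bernExp]

/-- Conditioning on the single element `e`. The inductions on `E` below rest on this identity. -/
theorem bernExp_insert {E : Finset α} {e : α} (he : e ∉ E) (p : ℝ) (f : Finset α → ℝ) :
    bernExp (insert e E) p f =
      (1 - p) * bernExp E p f + p * bernExp E p (fun T => f (insert e T)) := by
  unfold bernExp
  rw [Finset.sum_powerset_insert he, Finset.mul_sum, Finset.mul_sum]
  congr 1
  · refine Finset.sum_congr rfl fun T hT => ?_
    have heT : e ∉ T := fun h => he (Finset.mem_powerset.1 hT h)
    rw [Finset.insert_sdiff_of_notMem _ heT, Finset.card_insert_of_notMem (by simp [he])]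
    ring
  · refine Finset.sum_congr rfl fun T hT => ?_
    have heT : e ∉ T := fun h => he (Finset.mem_powerset.1 hT h)
    rw [Finset.card_insert_of_notMem heT, Finset.insert_sdiff_insert,
      Finset.sdiff_insert_of_notMem he]
    ring

theorem bernExp_congr {E : Finset α} {p : ℝ} {f g : Finset α → ℝ}
    (h : ∀ T ⊆ E, f T = g T) : bernExp E p f = bernExp E p g :=
  Finset.sum_congr rfl fun T hT => by rw [h T (Finset.mem_powerset.1 hT)]

theorem bernExp_mono {E : Finset α} {p : ℝ} (hp0 : 0 ≤ p) (hp1 : p ≤ 1) {f g : Finset α → ℝ}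
    (h : ∀ T ⊆ E, f T ≤ g T) : bernExp E p f ≤ bernExp E p g := by
  refine Finset.sum_le_sum fun T hT => mul_le_mul_of_nonneg_left (h T (Finset.mem_powerset.1 hT)) ?_
  have : 0 ≤ 1 - p := by linarith
  positivity

theorem bernExp_const (E : Finset α) (p c : ℝ) : bernExp E p (fun _ => c) = c := by
  induction E using Finset.induction_on with
  | empty => simp [bernExp_empty]
  | insert e E he ih => rw [bernExp_insert he, ih]; ring

theorem bernExp_add (E : Finset α) (p : ℝ) (f g : Finset α → ℝ) :
    bernExp E p (fun T => f T + g T) = bernExp E p f + bernExp E p g := by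
  simp [bernExp, mul_add, Finset.sum_add_distrib]

theorem bernExp_const_mul (E : Finset α) (p c : ℝ) (f : Finset α → ℝ) :
    bernExp E p (fun T => c * f T) = c * bernExp E p f := by
  simp only [bernExp, Finset.mul_sum]
  exact Finset.sum_congr rfl fun _ _ => by ring

theorem bernExp_neg (E : Finset α) (p : ℝ) (f : Finset α → ℝ) :
    bernExp E p (fun T => - f T) = - bernExp E p f := by
  simpa using bernExp_const_mul E p (-1) f

theorem bernExp_one_sub (E : Finset α) (p : ℝ) (f : Finset α → ℝ) :
    bernExp E p (fun T => 1 - f T) = 1 - bernExp E p f := by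
  have := bernExp_add E p (fun _ => 1) (fun T => - f T)
  rw [bernExp_const, bernExp_neg] at this
  simpa [sub_eq_add_neg] using this

theorem bernExp_sum {ι : Type*} (s : Finset ι) (E : Finset α) (p : ℝ) (f : ι → Finset α → ℝ) :
    bernExp E p (fun T => ∑ i ∈ s, f i T) = ∑ i ∈ s, bernExp E p (f i) := by
  simp only [bernExp, Finset.mul_sum]
  rw [Finset.sum_comm]

/-- The union of two independent random subsets of densities `p` and `q` is a random subset of
density `1 - (1 - p) (1 - q)`. -/
theorem bernExp_union (E : Finset α) (p q r : ℝ) (hr : 1 - r = (1 - p) * (1 - q))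
    (f : Finset α → ℝ) :
    bernExp E r f = bernExp E p (fun T => bernExp E q (fun T' => f (T ∪ T'))) := by
  obtain rfl : r = p + q - p * q := by linarith
  induction E using Finset.induction_on generalizing f with
  | empty => simp [bernExp_empty]
  | insert e E he ih =>
    simp only [bernExp_insert he, bernExp_add, bernExp_const_mul, Finset.insert_union,
      Finset.union_insert, Finset.insert_idem]
    rw [ih f, ih fun T => f (insert e T)]
    ring

/-- `f T` depends only on `T ∩ F`. -/
def DependsOnInter (F : Finset α) (f : Finset α → ℝ) : Prop :=
  ∀ T T' : Finset α, T ∩ F = T' ∩ F → f T = f T'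

theorem DependsOnInter.insert_eq {F : Finset α} {f : Finset α → ℝ} (h : DependsOnInter F f)
    {e : α} (he : e ∉ F) (T : Finset α) : f (insert e T) = f T :=
  h _ _ (Finset.insert_inter_of_notMem he)

theorem DependsOnInter.comp_insert {F : Finset α} {f : Finset α → ℝ} (h : DependsOnInter F f)
    (e : α) : DependsOnInter F (fun T => f (insert e T)) := by
  intro T T' hT
  apply h
  by_cases he : e ∈ F
  · rw [Finset.insert_inter_of_mem he, Finset.insert_inter_of_mem he, hT]
  · rw [Finset.insert_inter_of_notMem he, Finset.insert_inter_of_notMem he, hT]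

theorem DependsOnInter.mono {F F' : Finset α} {f : Finset α → ℝ} (h : DependsOnInter F f)
    (hF : F ⊆ F') : DependsOnInter F' f := by
  intro T T' hT
  apply h
  rw [← Finset.inter_eq_right.2 hF, ← Finset.inter_assoc, hT, Finset.inter_assoc]

theorem DependsOnInter.prod {ι : Type*} {s : Finset ι} {F : ι → Finset α}
    {f : ι → Finset α → ℝ} (h : ∀ i ∈ s, DependsOnInter (F i) (f i)) :
    DependsOnInter (s.biUnion F) (fun T => ∏ i ∈ s, f i T) := by
  intro T T' hT
  refine Finset.prod_congr rfl fun i hi => ?_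
  exact (h i hi).mono (Finset.subset_biUnion_of_mem F hi) T T' hT

/-- Functions depending on disjoint sets of coordinates are independent. -/
theorem bernExp_mul {E F F' : Finset α} (p : ℝ) {f g : Finset α → ℝ} (hf : DependsOnInter F f)
    (hg : DependsOnInter F' g) (hFF : Disjoint F F') :
    bernExp E p (fun T => f T * g T) = bernExp E p f * bernExp E p g := by
  induction E using Finset.induction_on generalizing f g with
  | empty => simp [bernExp_empty]
  | insert e E he ih =>
    simp only [bernExp_insert he]
    rw [ih hf hg, ih (hf.comp_insert e) (hg.comp_insert e)]
    by_cases heF : e ∈ F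
    · have heF' : e ∉ F' := Finset.disjoint_left.1 hFF heF
      simp only [hg.insert_eq heF']
      ring
    · simp only [hf.insert_eq heF]
      ring

theorem bernExp_prod {ι : Type*} [DecidableEq ι] {E : Finset α} (p : ℝ) {s : Finset ι}
    {F : ι → Finset α} {f : ι → Finset α → ℝ} (h : ∀ i ∈ s, DependsOnInter (F i) (f i))
    (hF : ∀ i ∈ s, ∀ j ∈ s, i ≠ j → Disjoint (F i) (F j)) :
    bernExp E p (fun T => ∏ i ∈ s, f i T) = ∏ i ∈ s, bernExp E p (f i) := by
  induction s using Finset.induction_on with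
  | empty => simp [bernExp_const]
  | insert i s hi ih =>
    simp only [Finset.prod_insert hi]
    rw [bernExp_mul (F := F i) (F' := s.biUnion F) p (h i (by simp))
      (DependsOnInter.prod fun j hj => h j (by simp [hj])), ih]
    · exact fun j hj => h j (by simp [hj])
    · exact fun j hj k hk => hF j (by simp [hj]) k (by simp [hk])
    · rw [Finset.disjoint_biUnion_right]
      intro j hj
      exact hF i (by simp) j (by simp [hj]) (by rintro rfl; exact hi hj)

open Classical in
theorem bernExp_mem {E : Finset α} (p : ℝ) {e : α} (he : e ∈ E) :
    bernExp E p (fun T => if e ∈ T then 1 else 0) = p := by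
  rw [← Finset.insert_erase he, bernExp_insert (by simp)]
  rw [bernExp_congr (g := fun _ => 0)]
  · simp [bernExp_const]
  · intro T hT
    rw [if_neg fun h => by simpa using hT h]

open Classical in
theorem bernExp_subset {E : Finset α} (p : ℝ) {P : Finset α} (hP : P ⊆ E) :
    bernExp E p (fun T => if P ⊆ T then 1 else 0) = p ^ P.card := by
  have h := bernExp_prod (E := E) p (s := P) (F := fun e => {e})
    (f := fun e T => if e ∈ T then 1 else 0) ?_ ?_
  · rw [Finset.prod_congr rfl fun e he => bernExp_mem p (hP he), Finset.prod_const] at h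
    rw [← h]
    refine bernExp_congr fun T _ => ?_
    rw [Finset.prod_boole]
    rfl
  · intro e _ T T' hT
    have : e ∈ T ∩ {e} ↔ e ∈ T' ∩ {e} := by rw [hT]
    simp only [Finset.mem_inter, Finset.mem_singleton, and_true] at this
    simp only [this]
  · intro e _ e' _ hne
    simpa using hne

/-- After centring at the mean, `exp z ≤ 1 + z + z ^ 2` for `|z| ≤ 1` applies at both points and the
linear terms cancel. This is the source of the condition `l * c ≤ 1` in the tail bounds. -/
theorem two_point_exp_bound {p x y : ℝ} (hp0 : 0 ≤ p) (hp1 : p ≤ 1) (h : |x - y| ≤ 1) :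
    (1 - p) * Real.exp x + p * Real.exp y
      ≤ Real.exp ((1 - p) * x + p * y + (x - y) ^ 2) := by
  have hq : 0 ≤ 1 - p := by linarith
  set μ := (1 - p) * x + p * y with hμ
  have hx : x - μ = p * (x - y) := by rw [hμ]; ring
  have hy : y - μ = -((1 - p) * (x - y)) := by rw [hμ]; ring
  have habs : |x - μ| ≤ 1 := by
    rw [hx, abs_mul, abs_of_nonneg hp0]
    exact mul_le_one₀ hp1 (abs_nonneg _) h
  have habs' : |y - μ| ≤ 1 := by
    rw [hy, abs_neg, abs_mul, abs_of_nonneg hq]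
    exact mul_le_one₀ (by linarith) (abs_nonneg _) h
  have h1 := (abs_le.1 (Real.abs_exp_sub_one_sub_id_le habs)).2
  have h2 := (abs_le.1 (Real.abs_exp_sub_one_sub_id_le habs')).2
  have hsx : (x - μ) ^ 2 ≤ (x - y) ^ 2 := by
    rw [hx, mul_pow]
    exact mul_le_of_le_one_left (sq_nonneg _) (pow_le_one₀ hp0 hp1)
  have hsy : (y - μ) ^ 2 ≤ (x - y) ^ 2 := by
    rw [hy, neg_sq, mul_pow]
    exact mul_le_of_le_one_left (sq_nonneg _) (pow_le_one₀ hq (by linarith))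
  have key : (1 - p) * Real.exp (x - μ) + p * Real.exp (y - μ) ≤ Real.exp ((x - y) ^ 2) := by
    have h3 := Real.add_one_le_exp ((x - y) ^ 2)
    have e1 : (1 - p) * Real.exp (x - μ) ≤ (1 - p) * (1 + (x - μ) + (x - y) ^ 2) :=
      mul_le_mul_of_nonneg_left (by linarith) hq
    have e2 : p * Real.exp (y - μ) ≤ p * (1 + (y - μ) + (x - y) ^ 2) :=
      mul_le_mul_of_nonneg_left (by linarith) hp0
    have e3 : (1 - p) * (1 + (x - μ) + (x - y) ^ 2) + p * (1 + (y - μ) + (x - y) ^ 2)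
        = 1 + (x - y) ^ 2 := by rw [hx, hy]; ring
    linarith
  calc (1 - p) * Real.exp x + p * Real.exp y
      = Real.exp μ * ((1 - p) * Real.exp (x - μ) + p * Real.exp (y - μ)) := by
        rw [mul_add, mul_left_comm, mul_left_comm _ p, ← Real.exp_add, ← Real.exp_add]
        simp
    _ ≤ Real.exp μ * Real.exp ((x - y) ^ 2) := mul_le_mul_of_nonneg_left key (Real.exp_pos _).le
    _ = _ := by rw [← Real.exp_add]

/-- Exponential moment bound for functions with bounded differences. -/
theorem bernExp_exp_le {E : Finset α} {p c l : ℝ} (hp0 : 0 ≤ p) (hp1 : p ≤ 1)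
    (hl : 0 ≤ l) (hlc : l * c ≤ 1) {f : Finset α → ℝ}
    (hf : ∀ T ⊆ E, ∀ e ∈ E, |f (insert e T) - f T| ≤ c) :
    bernExp E p (fun T => Real.exp (l * f T))
      ≤ Real.exp (l * bernExp E p f + E.card * (l * c) ^ 2) := by
  induction E using Finset.induction_on generalizing f with
  | empty => simp [bernExp_empty]
  | insert e E he ih =>
    have hc : 0 ≤ c := (abs_nonneg _).trans (hf ∅ (by simp) e (by simp))
    rw [bernExp_insert he, bernExp_insert he]
    have h1 := ih (f := f) fun T hT e' he' => hf T (hT.trans (Finset.subset_insert _ _)) e'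
      (by simp [he'])
    have h2 := ih (f := fun T => f (insert e T)) fun T hT e' he' => by
      rw [Finset.insert_comm e e' T]
      exact hf (insert e T) (Finset.insert_subset_insert _ hT) e' (by simp [he'])
    -- The conditional means given that `e` is absent or present. They differ by at most `c`, so
    -- averaging over `e` with the two-point bound costs one further summand `(l * c) ^ 2`.
    set x := bernExp E p f
    set y := bernExp E p (fun T => f (insert e T))
    have hxy : |x - y| ≤ c := by
      have hd : y - x = bernExp E p (fun T => f (insert e T) - f T) := by
        simp only [sub_eq_add_neg, bernExp_add, bernExp_neg, x, y]
      rw [abs_sub_comm, hd, abs_le]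
      constructor
      · rw [← bernExp_const E p (-c)]
        exact bernExp_mono hp0 hp1 fun T hT =>
          (abs_le.1 (hf T (hT.trans (Finset.subset_insert _ _)) e (by simp))).1
      · rw [← bernExp_const E p c]
        exact bernExp_mono hp0 hp1 fun T hT =>
          (abs_le.1 (hf T (hT.trans (Finset.subset_insert _ _)) e (by simp))).2
    have hlxy : |l * x - l * y| ≤ l * c := by
      rw [← mul_sub, abs_mul, abs_of_nonneg hl]
      exact mul_le_mul_of_nonneg_left hxy hl
    have hsq : (l * x - l * y) ^ 2 ≤ (l * c) ^ 2 := by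
      rw [← sq_abs]
      exact pow_le_pow_left₀ (abs_nonneg _) hlxy 2
    have hq : 0 ≤ 1 - p := by linarith
    calc _ ≤ (1 - p) * Real.exp (l * x + E.card * (l * c) ^ 2)
          + p * Real.exp (l * y + E.card * (l * c) ^ 2) :=
        add_le_add (mul_le_mul_of_nonneg_left h1 hq) (mul_le_mul_of_nonneg_left h2 hp0)
      _ = Real.exp (E.card * (l * c) ^ 2) *
          ((1 - p) * Real.exp (l * x) + p * Real.exp (l * y)) := by
        rw [Real.exp_add, Real.exp_add]; ring
      _ ≤ Real.exp (E.card * (l * c) ^ 2) *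
          Real.exp ((1 - p) * (l * x) + p * (l * y) + (l * c) ^ 2) := by
        refine mul_le_mul_of_nonneg_left ?_ (Real.exp_pos _).le
        refine (two_point_exp_bound hp0 hp1 (hlxy.trans hlc)).trans ?_
        exact Real.exp_le_exp.2 (by linarith)
      _ = _ := by
        rw [← Real.exp_add, Finset.card_insert_of_notMem he]
        push_cast
        congr 1
        ring

open Classical in
/-- Upper tail bound for functions with bounded differences. -/
theorem bernExp_upper_tail {E : Finset α} {p c l s : ℝ} (hp0 : 0 ≤ p) (hp1 : p ≤ 1)
    (hl : 0 ≤ l) (hlc : l * c ≤ 1) {f : Finset α → ℝ}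
    (hf : ∀ T ⊆ E, ∀ e ∈ E, |f (insert e T) - f T| ≤ c) :
    bernExp E p (fun T => if bernExp E p f + s ≤ f T then 1 else 0)
      ≤ Real.exp (- (l * s) + E.card * (l * c) ^ 2) := by
  set μ := bernExp E p f
  calc _ ≤ bernExp E p (fun T => Real.exp (-(l * (μ + s))) * Real.exp (l * f T)) := by
        refine bernExp_mono hp0 hp1 fun T _ => ?_
        rw [← Real.exp_add]
        split_ifs with h
        · rw [Real.one_le_exp_iff]
          have := mul_le_mul_of_nonneg_left h hl
          linarith
        · exact (Real.exp_pos _).le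
    _ ≤ Real.exp (-(l * (μ + s))) * Real.exp (l * μ + E.card * (l * c) ^ 2) := by
        rw [bernExp_const_mul]
        exact mul_le_mul_of_nonneg_left (bernExp_exp_le hp0 hp1 hl hlc hf) (Real.exp_pos _).le
    _ = _ := by
        rw [← Real.exp_add]
        congr 1
        ring

open Classical in
/-- Lower tail bound for functions with bounded differences. -/
theorem bernExp_lower_tail {E : Finset α} {p c l s : ℝ} (hp0 : 0 ≤ p) (hp1 : p ≤ 1)
    (hl : 0 ≤ l) (hlc : l * c ≤ 1) {f : Finset α → ℝ}
    (hf : ∀ T ⊆ E, ∀ e ∈ E, |f (insert e T) - f T| ≤ c) :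
    bernExp E p (fun T => if f T ≤ bernExp E p f - s then 1 else 0)
      ≤ Real.exp (- (l * s) + E.card * (l * c) ^ 2) := by
  have h := bernExp_upper_tail (f := fun T => - f T) (s := s) hp0 hp1 hl hlc fun T hT e he => by
    rw [neg_sub_neg, abs_sub_comm]; exact hf T hT e he
  rw [bernExp_neg] at h
  refine le_trans (le_of_eq (bernExp_congr fun T _ => ?_)) h
  refine if_congr ?_ rfl rfl
  constructor <;> intro h <;> linarith

end BernoulliExpectation

/-! ### From the percolation measure to finite expectations -/

open Classical in
-- The measure is carried by the finitely many subsets of `E`, so the mass of `S` is the sum of the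
-- masses of these atoms.
theorem setBernoulli_real_eq_bernExp {α : Type*} [Finite α] [DecidableEq α] (E : Finset α) (p : unitInterval)
    (S : Set (Set α)) :
    (setBernoulli (E : Set α) p).real S =
      bernExp E (p : ℝ) (fun T => if (T : Set α) ∈ S then 1 else 0) := by
  have hdec : {s | s ∈ S ∧ s ⊆ (E : Set α)} =
      ⋃ T ∈ E.powerset.filter (fun T : Finset α => (T : Set α) ∈ S), {(T : Set α)} := by
    ext s
    simp only [Set.mem_ofPred_eq, Set.mem_iUnion, Finset.mem_filter, Finset.mem_powerset,
      Set.mem_singleton_iff, exists_prop]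
    constructor
    · rintro ⟨h1, h2⟩
      refine ⟨(Set.toFinite s).toFinset, ⟨?_, ?_⟩, ?_⟩
      · intro x hx; exact h2 (by simpa using hx)
      · simpa using h1
      · simp
    · rintro ⟨T, ⟨hT, hS⟩, rfl⟩
      exact ⟨hS, by exact_mod_cast hT⟩
  rw [measureReal_def, setBernoulli_apply_eq_apply_subsets, ← measureReal_def, hdec,
    measureReal_biUnion_finset]
  · simp only [bernExp, mul_ite, mul_one, mul_zero]
    rw [Finset.sum_filter]
    refine Finset.sum_congr rfl fun T hT => ?_
    split_ifs
    · rw [setBernoulli_real_singleton p (by exact_mod_cast Finset.mem_powerset.1 hT)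
        E.finite_toSet, Set.ncard_coe_finset, ← Finset.coe_sdiff, Set.ncard_coe_finset]
    · rfl
  · intro T _ T' _ hne
    simpa using hne
  · intro T _
    exact measurableSet_singleton _

open Classical in
theorem percolation_real_eq_bernExp {V : Type*} [Fintype V] [DecidableEq V]
    (G : SimpleGraph V) [DecidableRel G.Adj] (p : unitInterval) (S : Set (SimpleGraph V)) :
    (percolation G p).real S =
      bernExp G.edgeFinset (p : ℝ)
        (fun T => if SimpleGraph.fromEdgeSet (T : Set (Sym2 V)) ∈ S then 1 else 0) := by
  have hS : MeasurableSet S := by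
    rw [← SimpleGraph.measurableEmbedding_edgeSet.measurableSet_image]
    exact (Set.toFinite _).measurableSet
  unfold percolation
  rw [measureReal_def, Measure.map_apply (by fun_prop) hS, ← measureReal_def,
    ← SimpleGraph.coe_edgeFinset, setBernoulli_real_eq_bernExp]
  rfl

/-! ### Survival probabilities of percolated trees -/

/-- The probability that the root of a `k`-ary tree percolated with parameter `p` is connected to
distance `n`. -/
noncomputable def branchProb (k : ℕ) (p : ℝ) : ℕ → ℝ
  | 0 => 1
  | n + 1 => 1 - (1 - p * branchProb k p n) ^ k

/-- The probability that the root of a `d`-regular tree percolated with parameter `p` is connected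
to distance `n + 1`. -/
noncomputable def rootProb (d : ℕ) (p : ℝ) (n : ℕ) : ℝ :=
  1 - (1 - p * branchProb (d - 1) p n) ^ d

theorem one_sub_pow_mono {k : ℕ} {x y : ℝ} (hxy : x ≤ y) (hy : y ≤ 1) :
    1 - (1 - x) ^ k ≤ 1 - (1 - y) ^ k := by
  have : (1 - y) ^ k ≤ (1 - x) ^ k := pow_le_pow_left₀ (by linarith) (by linarith) k
  linarith

theorem branchProb_mem {k : ℕ} {p : ℝ} (hp0 : 0 ≤ p) (hp1 : p ≤ 1) (n : ℕ) :
    0 ≤ branchProb k p n ∧ branchProb k p n ≤ 1 := by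
  induction n with
  | zero => simp [branchProb]
  | succ n ih =>
    have h1 : p * branchProb k p n ≤ 1 := mul_le_one₀ hp1 ih.1 ih.2
    have h2 : 0 ≤ p * branchProb k p n := mul_nonneg hp0 ih.1
    constructor
    · have : (1 - p * branchProb k p n) ^ k ≤ 1 := pow_le_one₀ (by linarith) (by linarith)
      simp only [branchProb]; linarith
    · have : 0 ≤ (1 - p * branchProb k p n) ^ k := pow_nonneg (by linarith) _
      simp only [branchProb]; linarith

theorem branchProb_antitone {k : ℕ} {p : ℝ} (hp0 : 0 ≤ p) (hp1 : p ≤ 1) :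
    Antitone (branchProb k p) := by
  refine antitone_nat_of_succ_le fun n => ?_
  induction n with
  | zero => exact (branchProb_mem hp0 hp1 1).2
  | succ n ih =>
    exact one_sub_pow_mono (mul_le_mul_of_nonneg_left ih hp0)
      (mul_le_one₀ hp1 (branchProb_mem hp0 hp1 n).1 (branchProb_mem hp0 hp1 n).2)

/-- The one-step map is monotone, so a point below its own image stays below every iterate started
at `1`. -/
theorem le_branchProb_of_le {k : ℕ} {p u : ℝ} (hp0 : 0 ≤ p) (hp1 : p ≤ 1) (hu1 : u ≤ 1)
    (hu : u ≤ 1 - (1 - p * u) ^ k) (n : ℕ) : u ≤ branchProb k p n := by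
  induction n with
  | zero => exact hu1
  | succ n ih =>
    exact hu.trans (one_sub_pow_mono (mul_le_mul_of_nonneg_left ih hp0)
      (mul_le_one₀ hp1 (branchProb_mem hp0 hp1 n).1 (branchProb_mem hp0 hp1 n).2))

/-- In the supercritical regime the one-step map lies above the diagonal near zero. -/
theorem exists_pos_lt_one_sub_pow {k : ℕ} {p : ℝ} (hp1 : p ≤ 1) (hpk : 1 < p * k) :
    ∃ u, 0 < u ∧ u < 1 ∧ u < 1 - (1 - p * u) ^ k := by
  set c := p * k with hc
  have hc0 : 0 < c := by linarith
  have hk : (k : ℝ) ≠ 0 := by rintro h; rw [hc, h] at hpk; norm_num at hpk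
  have hk1 : (1 : ℝ) ≤ k := by
    have : k ≠ 0 := by exact_mod_cast hk
    exact_mod_cast Nat.one_le_iff_ne_zero.2 this
  have hp0 : 0 < p := by
    by_contra h
    have : p * k ≤ 0 := mul_nonpos_of_nonpos_of_nonneg (not_lt.1 h) (by positivity)
    linarith
  have hu0 : 0 < (c - 1) / (2 * c) := div_pos (by linarith) (by linarith)
  have hu2 : (c - 1) / (2 * c) < 1 := by rw [div_lt_one (by linarith)]; linarith
  -- With this witness `c * u = (c - 1) / 2`, hence `(1 - u) * (1 + c * u) = 1 + u * (c - 1) / 2 >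
  -- 1`. Bernoulli's inequality gives `(1 - p * u) ^ k * (1 + c * u) ≤ 1`, and comparing the two
  -- finishes.
  refine ⟨(c - 1) / (2 * c), hu0, hu2, ?_⟩
  set u := (c - 1) / (2 * c) with hu
  have hcu : c * u = (c - 1) / 2 := by rw [hu]; field_simp
  have hx1 : p * u ≤ 1 := mul_le_one₀ hp1 hu0.le hu2.le
  have hx0 : 0 < p * u := mul_pos hp0 hu0
  have h1 : (1 - p * u) ^ k * (1 + c * u) ≤ 1 := by
    calc (1 - p * u) ^ k * (1 + c * u) ≤ (1 - p * u) ^ k * (1 + p * u) ^ k := by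
          refine mul_le_mul_of_nonneg_left ?_ (pow_nonneg (by linarith) _)
          have := one_add_mul_le_pow (a := p * u) (by linarith) k
          refine le_trans (le_of_eq ?_) this
          rw [hc]; ring
      _ = (1 - (p * u) ^ 2) ^ k := by rw [← mul_pow]; ring
      _ ≤ 1 := pow_le_one₀ (by nlinarith) (by nlinarith)
  have h2 : 1 < (1 - u) * (1 + c * u) := by
    have : (1 - u) * (1 + c * u) = 1 + u * (c - 1 - c * u) := by ring
    rw [this, hcu]
    have : 0 < u * (c - 1 - (c - 1) / 2) := mul_pos hu0 (by linarith)
    linarith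
  have h3 : 0 < 1 + c * u := by positivity
  have := lt_of_mul_lt_mul_right (h1.trans_lt h2) h3.le
  linarith

/-- The one-step map is strictly concave, hence lies above the diagonal below a fixed point. -/
theorem lt_one_sub_pow_of_lt {k : ℕ} (hk : 2 ≤ k) {p L t : ℝ} (hp0 : 0 < p) (hp1 : p ≤ 1)
    (hL0 : 0 < L) (hL1 : L ≤ 1) (hL : L = 1 - (1 - p * L) ^ k) (ht0 : 0 < t) (ht1 : t < 1) :
    t * L < 1 - (1 - p * (t * L)) ^ k := by
  have hsc := (strictConvexOn_pow (n := k) hk)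
  have hm1 : (1 : ℝ) ∈ Set.Ici (0 : ℝ) := by simp
  have hm2 : 1 - p * L ∈ Set.Ici (0 : ℝ) := by
    have := mul_le_one₀ hp1 hL0.le hL1
    simp [this]
  have hne : (1 : ℝ) ≠ 1 - p * L := by have := mul_pos hp0 hL0; linarith
  have h := hsc.2 hm1 hm2 hne (show 0 < 1 - t by linarith) ht0 (by ring)
  simp only [smul_eq_mul, one_pow, mul_one] at h
  have e : 1 - t + t * (1 - p * L) = 1 - p * (t * L) := by ring
  rw [e] at h
  have : (1 - p * L) ^ k = 1 - L := by linarith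
  rw [this] at h
  linarith

open Filter Topology in
/-- Continuity of the survival probability from the left: a slightly smaller parameter loses only a
small proportion of the vertices connected to a large distance. -/
theorem exists_smaller_parameter {d : ℕ} (hd : 3 ≤ d) {p : ℝ} (hp : 1 / ((d : ℝ) - 1) < p)
    (hp1 : p ≤ 1) {κ : ℝ} (hκ : 0 < κ) :
    ∃ θ p' : ℝ, 0 < θ ∧ 0 < p' ∧ p' < p ∧ (∀ n, (1 - κ) * θ ≤ rootProb d p' n) ∧
      ∃ n₀, ∀ n ≥ n₀, rootProb d p n ≤ (1 + κ) * θ := by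
  have hd3 : (3 : ℝ) ≤ d := by exact_mod_cast hd
  have hp0 : 0 < p := lt_trans (div_pos one_pos (by linarith)) hp
  set k := d - 1 with hk
  have hk2 : 2 ≤ k := by omega
  have hkd : (k : ℝ) = d - 1 := by rw [hk, Nat.cast_sub (by omega)]; simp
  have hpk : 1 < p * k := by
    rw [hkd]
    rwa [div_lt_iff₀ (by linarith)] at hp
  obtain ⟨u, hu0, hu1, hu⟩ := exists_pos_lt_one_sub_pow hp1 hpk
  have hbdd : BddBelow (Set.range (branchProb k p)) :=
    ⟨0, by rintro _ ⟨n, rfl⟩; exact (branchProb_mem hp0.le hp1 n).1⟩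
  have hlim := tendsto_atTop_ciInf (branchProb_antitone (k := k) hp0.le hp1) hbdd
  set L := ⨅ n, branchProb k p n
  have hL0 : 0 < L :=
    lt_of_lt_of_le hu0 (le_ciInf fun n => le_branchProb_of_le hp0.le hp1 hu1.le hu.le n)
  have hL1 : L ≤ 1 := ciInf_le hbdd 0
  have hLfix : L = 1 - (1 - p * L) ^ k := by
    refine tendsto_nhds_unique ((tendsto_add_atTop_iff_nat 1).2 hlim) ?_
    exact ((((hlim.const_mul p).const_sub 1).pow k).const_sub 1)
  have hpL1 : p * L ≤ 1 := mul_le_one₀ hp1 hL0.le hL1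
  have hpL0 : 0 < p * L := mul_pos hp0 hL0
  set θ := 1 - (1 - p * L) ^ d with hθ
  have hθ0 : 0 < θ := by
    have : (1 - p * L) ^ d < 1 := pow_lt_one₀ (by linarith) (by linarith) (by omega)
    linarith
  have hroot : Tendsto (rootProb d p) atTop (𝓝 θ) :=
    (((hlim.const_mul p).const_sub 1).pow d).const_sub 1
  have hev : ∀ᶠ n in atTop, rootProb d p n < (1 + κ) * θ :=
    hroot.eventually_lt_const (by nlinarith)
  obtain ⟨n₀, hn₀⟩ := eventually_atTop.1 hev
  have ht : ∀ᶠ t in 𝓝[<] (1 : ℝ), (1 - κ) * θ < 1 - (1 - p * (t * L)) ^ d := by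
    refine Filter.Eventually.filter_mono nhdsWithin_le_nhds ?_
    have hc : Continuous fun t : ℝ => 1 - (1 - p * (t * L)) ^ d := by fun_prop
    refine (hc.tendsto 1).eventually_const_lt ?_
    rw [one_mul, ← hθ]
    nlinarith
  have ht01 : ∀ᶠ t in 𝓝[<] (1 : ℝ), t ∈ Set.Ioo (0 : ℝ) 1 := Ioo_mem_nhdsLT one_pos
  obtain ⟨t, htθ, ht0, ht1⟩ := (ht.and ht01).exists
  -- At `t * L` the one-step map for `p` lies strictly above the diagonal. This is an open condition
  -- on the parameter, so it persists for some `p' < p`, and `le_branchProb_of_le` then bounds every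
  -- `branchProb k p' n` below by `t * L`.
  have htL := lt_one_sub_pow_of_lt hk2 hp0 hp1 hL0 hL1 hLfix ht0 ht1
  have e1 : ∀ᶠ p' in 𝓝[<] p, (1 - κ) * θ < 1 - (1 - p' * (t * L)) ^ d := by
    refine Filter.Eventually.filter_mono nhdsWithin_le_nhds ?_
    have hc : Continuous fun p' : ℝ => 1 - (1 - p' * (t * L)) ^ d := by fun_prop
    exact (hc.tendsto p).eventually_const_lt htθ
  have e2 : ∀ᶠ p' in 𝓝[<] p, t * L < 1 - (1 - p' * (t * L)) ^ k := by
    refine Filter.Eventually.filter_mono nhdsWithin_le_nhds ?_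
    have hc : Continuous fun p' : ℝ => 1 - (1 - p' * (t * L)) ^ k := by fun_prop
    exact (hc.tendsto p).eventually_const_lt htL
  have e3 : ∀ᶠ p' in 𝓝[<] p, p' ∈ Set.Ioo 0 p := Ioo_mem_nhdsLT hp0
  obtain ⟨p', h1, h2, h3, h4⟩ := (e1.and (e2.and e3)).exists
  have htL1 : t * L ≤ 1 := mul_le_one₀ ht1.le hL0.le hL1
  refine ⟨θ, p', hθ0, h3, h4, fun n => ?_, n₀, fun n hn => (hn₀ n hn).le⟩
  have hp'1 : p' ≤ 1 := by linarith
  refine h1.le.trans (one_sub_pow_mono (mul_le_mul_of_nonneg_left ?_ h3.le) ?_)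
  · exact le_branchProb_of_le h3.le hp'1 htL1 h2.le n
  · exact mul_le_one₀ hp'1 (branchProb_mem h3.le hp'1 n).1 (branchProb_mem h3.le hp'1 n).2

/-! ### Balls in graphs of bounded degree -/

section Balls

variable {V : Type*} [Fintype V]

open Classical in
/-- The vertices joined to `v` by a walk of length at most `i`. -/
noncomputable def walkBall (G : SimpleGraph V) (v : V) (i : ℕ) : Finset V :=
  {w | ∃ p : G.Walk v w, p.length ≤ i}

theorem mem_walkBall {G : SimpleGraph V} {v w : V} {i : ℕ} :
    w ∈ walkBall G v i ↔ ∃ p : G.Walk v w, p.length ≤ i := by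
  simp [walkBall]

theorem self_mem_walkBall (G : SimpleGraph V) (v : V) (i : ℕ) : v ∈ walkBall G v i :=
  mem_walkBall.2 ⟨.nil, by simp⟩

theorem mem_walkBall_symm {G : SimpleGraph V} {v w : V} {i : ℕ} (h : w ∈ walkBall G v i) :
    v ∈ walkBall G w i := by
  obtain ⟨p, hp⟩ := mem_walkBall.1 h
  exact mem_walkBall.2 ⟨p.reverse, by simpa⟩

theorem mem_walkBall_trans {G : SimpleGraph V} {u v w : V} {i j : ℕ} (h : v ∈ walkBall G u i)
    (h' : w ∈ walkBall G v j) : w ∈ walkBall G u (i + j) := by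
  obtain ⟨p, hp⟩ := mem_walkBall.1 h
  obtain ⟨q, hq⟩ := mem_walkBall.1 h'
  exact mem_walkBall.2 ⟨p.append q, by simp; omega⟩

theorem walkBall_mono {G H : SimpleGraph V} (hGH : G ≤ H) {i j : ℕ} (hij : i ≤ j) (v : V) :
    walkBall G v i ⊆ walkBall H v j := by
  intro w hw
  obtain ⟨p, hp⟩ := mem_walkBall.1 hw
  exact mem_walkBall.2 ⟨p.mapLe hGH, by simpa using hp.trans hij⟩

theorem card_walkBall_le {G : SimpleGraph V} [DecidableRel G.Adj] {d : ℕ}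
    (hd : ∀ v, G.degree v ≤ d) (v : V) (i : ℕ) : (walkBall G v i).card ≤ (d + 1) ^ i := by
  classical
  induction i generalizing v with
  | zero =>
    have : walkBall G v 0 ⊆ {v} := by
      intro w hw
      obtain ⟨p, hp⟩ := mem_walkBall.1 hw
      have := SimpleGraph.Walk.eq_of_length_eq_zero (Nat.le_zero.1 hp)
      simp [this]
    simpa using Finset.card_le_card this
  | succ i ih =>
    have hsub : walkBall G v (i + 1) ⊆
        insert v ((G.neighborFinset v).biUnion fun w => walkBall G w i) := by
      intro w hw
      obtain ⟨p, hp⟩ := mem_walkBall.1 hw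
      cases p with
      | nil => simp
      | cons h q =>
        rw [SimpleGraph.Walk.length_cons] at hp
        refine Finset.mem_insert_of_mem (Finset.mem_biUnion.2 ⟨_, by simpa using h, ?_⟩)
        exact mem_walkBall.2 ⟨q, by omega⟩
    have h1 : ((G.neighborFinset v).biUnion fun w => walkBall G w i).card ≤ d * (d + 1) ^ i := by
      refine (Finset.card_biUnion_le_card_mul _ _ _ fun w _ => ih w).trans ?_
      exact Nat.mul_le_mul_right _ (hd v)
    calc _ ≤ _ := Finset.card_le_card hsub
      _ ≤ d * (d + 1) ^ i + 1 := (Finset.card_insert_le _ _).trans (by omega)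
      _ ≤ d * (d + 1) ^ i + (d + 1) ^ i := by
        have : 1 ≤ (d + 1) ^ i := Nat.one_le_pow _ _ (by omega)
        omega
      _ = _ := by ring

end Balls

/-! ### Large girth: local uniqueness of paths -/

section Girth

variable {V : Type*} [DecidableEq V] {G : SimpleGraph V} {R : ℕ}

theorem isAcyclic_fromEdgeSet_of_card_le (hR : (R : ℕ∞) < G.egirth) (F : Finset (Sym2 V))
    (hF : (F : Set (Sym2 V)) ⊆ G.edgeSet) (hcard : F.card ≤ R) :
    (SimpleGraph.fromEdgeSet (F : Set (Sym2 V))).IsAcyclic := by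
  intro v c hc
  have hle : SimpleGraph.fromEdgeSet (F : Set (Sym2 V)) ≤ G := by
    intro x y hxy
    exact hF (((SimpleGraph.fromEdgeSet_adj _).1 hxy).1)
  have h1 := SimpleGraph.egirth_le_length (hc.mapLe hle)
  have h2 : c.length ≤ F.card := by
    rw [← SimpleGraph.Walk.length_edges, ← List.toFinset_card_of_nodup hc.edges_nodup]
    refine Finset.card_le_card fun e he => ?_
    have := c.edges_subset_edgeSet (List.mem_toFinset.1 he)
    rw [SimpleGraph.edgeSet_fromEdgeSet] at this
    exact_mod_cast this.1
  have h3 : (c.mapLe hle).length ≤ R := by simpa using h2.trans hcard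
  exact absurd (hR.trans_le h1) (not_lt.2 (by exact_mod_cast h3))

/-- The edges of both paths number at most `R`, so they span a forest, where paths are unique. -/
theorem path_unique_of_egirth (hR : (R : ℕ∞) < G.egirth) {u v : V} {p q : G.Walk u v}
    (hp : p.IsPath) (hq : q.IsPath) (hpq : p.length + q.length ≤ R) : p = q := by
  set F : Finset (Sym2 V) := (p.edges ++ q.edges).toFinset with hF
  have hac := isAcyclic_fromEdgeSet_of_card_le hR F
    (by
      intro e he
      have he : e ∈ p.edges ++ q.edges := List.mem_toFinset.1 (by exact_mod_cast he)
      rcases List.mem_append.1 he with h | h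
      · exact p.edges_subset_edgeSet h
      · exact q.edges_subset_edgeSet h)
    ((List.toFinset_card_le _).trans (by simpa using hpq))
  have hmem : ∀ e ∈ p.edges ++ q.edges, e ∈ (SimpleGraph.fromEdgeSet (F : Set (Sym2 V))).edgeSet := by
    intro e he
    rw [SimpleGraph.edgeSet_fromEdgeSet]
    refine ⟨by exact_mod_cast List.mem_toFinset.2 he, ?_⟩
    have hG : e ∈ G.edgeSet := by
      rcases List.mem_append.1 he with h | h
      · exact p.edges_subset_edgeSet h
      · exact q.edges_subset_edgeSet h
    exact G.not_isDiag_of_mem_edgeSet hG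
  have hp' := fun e he => hmem e (List.mem_append_left _ he)
  have hq' := fun e he => hmem e (List.mem_append_right _ he)
  have h := (hac.subsingleton_path u v).elim ⟨p.transfer _ hp', hp.transfer hp'⟩
    ⟨q.transfer _ hq', hq.transfer hq'⟩
  have h2 : p.transfer _ hp' = q.transfer _ hq' := congrArg Subtype.val h
  apply SimpleGraph.Walk.ext_support
  rw [← p.support_transfer hp', h2, q.support_transfer]

theorem dist_le_of_mem_support {r x y : V} {p : G.Walk r y} (hx : x ∈ p.support) (hxy : x ≠ y) :
    G.dist r x < p.length :=
  (SimpleGraph.dist_le (p.takeUntil x hx)).trans_lt (p.length_takeUntil_lt_length hx hxy)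

/-- Geodesics from `r` to `y` and to `z`, each prolonged to `x`, are two short paths with the same
ends; their penultimate vertices agree. -/
theorem unique_parent_of_egirth (hR : (R : ℕ∞) < G.egirth) {r x y z : V} {i : ℕ}
    (hi : 2 * (i + 1) ≤ R) (hx : G.dist r x = i + 1) (hy : G.dist r y = i) (hz : G.dist r z = i)
    (hyx : G.Adj y x) (hzx : G.Adj z x) : y = z := by
  have hrx : G.Reachable r x := by
    by_contra h
    rw [SimpleGraph.dist_eq_zero_of_not_reachable h] at hx
    omega
  obtain ⟨p, hp, hpl⟩ := (hrx.trans hyx.symm.reachable).exists_path_of_dist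
  obtain ⟨q, hq, hql⟩ := (hrx.trans hzx.symm.reachable).exists_path_of_dist
  have hxp : x ∉ p.support := fun h => by
    have := dist_le_of_mem_support h hyx.ne.symm
    omega
  have hxq : x ∉ q.support := fun h => by
    have := dist_le_of_mem_support h hzx.ne.symm
    omega
  have h := path_unique_of_egirth hR (hp.concat hxp hyx) (hq.concat hxq hzx)
    (by simp only [SimpleGraph.Walk.length_concat]; omega)
  exact (SimpleGraph.Walk.concat_inj h).1

/-- An edge inside a sphere would give two short paths from `r` to `x` of lengths `i` and `i + 1`.
-/
theorem dist_ne_of_egirth (hR : (R : ℕ∞) < G.egirth) {r x y : V} {i : ℕ}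
    (hi : 2 * (i + 1) ≤ R) (hrx : G.Reachable r x) (hx : G.dist r x = i) (hxy : G.Adj x y) :
    G.dist r y ≠ i := by
  intro hy
  obtain ⟨p, hp, hpl⟩ := hrx.exists_path_of_dist
  obtain ⟨q, hq, hql⟩ := (hrx.trans hxy.reachable).exists_path_of_dist
  have hxq : x ∉ q.support := fun h => by
    have := dist_le_of_mem_support h hxy.ne
    omega
  have h := path_unique_of_egirth hR hp (hq.concat hxq hxy.symm)
    (by simp only [SimpleGraph.Walk.length_concat]; omega)
  have := congrArg SimpleGraph.Walk.length h
  simp only [SimpleGraph.Walk.length_concat] at this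
  omega

end Girth

/-! ### Descending paths and the branching recursion -/

section Descent

variable {V : Type*} {G : SimpleGraph V} {m : ℕ} {r : V}

/-- `w` lies one step further from `r` than its neighbour `v`. -/
def IsChild (G : SimpleGraph V) (r v w : V) : Prop :=
  G.Adj v w ∧ G.dist r w = G.dist r v + 1

theorem IsChild.reachable {v w : V} (h : IsChild G r v w) : G.Reachable r v := by
  by_contra hn
  have h1 : ¬ G.Reachable r w := fun h' => hn (h'.trans h.1.symm.reachable)
  have h2 := h.2
  rw [SimpleGraph.dist_eq_zero_of_not_reachable h1] at h2
  omega

theorem dist_le_of_descendant {v w : V} (h : Relation.ReflTransGen (IsChild G r) v w) :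
    G.dist r v ≤ G.dist r w := by
  induction h with
  | refl => exact le_rfl
  | tail _ h ih => exact ih.trans (by rw [h.2]; omega)

/-- There is a path of `n` edges in `T` starting at `v` and moving away from `r`. -/
def Survives (G : SimpleGraph V) (T : Finset (Sym2 V)) (r : V) : ℕ → V → Prop
  | 0, _ => True
  | n + 1, v => ∃ w, IsChild G r v w ∧ s(v, w) ∈ T ∧ Survives G T r n w

theorem Survives.mono {T T' : Finset (Sym2 V)} (hT : T ⊆ T') {n : ℕ} {v : V}
    (h : Survives G T r n v) : Survives G T' r n v := by
  induction n generalizing v with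
  | zero => trivial
  | succ n ih =>
    obtain ⟨w, hw, hT', h'⟩ := h
    exact ⟨w, hw, hT hT', ih h'⟩

open Classical in
/-- The indicator function of `Survives`. -/
noncomputable def survivalInd (G : SimpleGraph V) (r : V) (n : ℕ) (v : V)
    (T : Finset (Sym2 V)) : ℝ :=
  if Survives G T r n v then 1 else 0

theorem isChild_lower_unique {x y x' y' : V} (h : s(x, y) = s(x', y')) (h1 : IsChild G r x y)
    (h2 : IsChild G r x' y') : x = x' ∧ y = y' := by
  rcases Sym2.eq_iff.1 h with ⟨rfl, rfl⟩ | ⟨rfl, rfl⟩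
  · exact ⟨rfl, rfl⟩
  · have := h1.2
    have := h2.2
    omega

section Children

variable [Fintype V]

open Classical in
/-- The neighbours of `v` which are further from `r`. -/
noncomputable def children (G : SimpleGraph V) (r v : V) : Finset V :=
  {w | IsChild G r v w}

theorem mem_children {v w : V} : w ∈ children G r v ↔ IsChild G r v w := by
  simp [children]

theorem card_children_root {d : ℕ} [DecidableRel G.Adj]
    (hd : G.IsRegularOfDegree d) (r : V) :
    (children G r r).card = d := by
  rw [← hd r, ← SimpleGraph.card_neighborFinset_eq_degree]
  congr 1
  ext w
  rw [mem_children, SimpleGraph.mem_neighborFinset]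
  refine ⟨fun h => h.1, fun h => ⟨h, ?_⟩⟩
  rw [SimpleGraph.dist_self, SimpleGraph.dist_eq_one_iff_adj.2 h]

end Children

variable [DecidableEq V]

theorem IsChild.unique (hg : ((2 * (m + 1) : ℕ) : ℕ∞) < G.egirth) {v w x : V}
    (hx : G.dist r x ≤ m) (hv : IsChild G r v x) (hw : IsChild G r w x) : v = w :=
  unique_parent_of_egirth hg (i := G.dist r v) (by have := hv.2; omega) hv.2 rfl
    (by have := hv.2; have := hw.2; omega) hv.1 hw.1

/-- Below the girth scale, a vertex has at most one ancestor at each level. -/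
theorem ancestor_unique (hg : ((2 * (m + 1) : ℕ) : ℕ∞) < G.egirth) {v w x : V}
    (hx : G.dist r x ≤ m) (hv : Relation.ReflTransGen (IsChild G r) v x)
    (hw : Relation.ReflTransGen (IsChild G r) w x) (hvw : G.dist r v = G.dist r w) : v = w := by
  induction hv with
  | refl =>
    cases hw with
    | refl => rfl
    | tail hw h =>
      have := dist_le_of_descendant hw
      have := h.2
      omega
  | tail hv h ih =>
    cases hw with
    | refl =>
      have := dist_le_of_descendant hv
      have := h.2
      omega
    | tail hw h' =>
      obtain rfl := h.unique hg hx h'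
      exact ih (by have := h.2; omega) hw

section Children

variable [Fintype V] [DecidableRel G.Adj]

/-- Away from the root exactly one neighbour is a parent, and no neighbour is at the same distance,
so the other `d - 1` are children. -/
theorem card_children {d : ℕ} (hd : G.IsRegularOfDegree d)
    (hg : ((2 * (m + 1) : ℕ) : ℕ∞) < G.egirth) {v : V} (hr : G.Reachable r v) (hvr : v ≠ r)
    (hm : G.dist r v ≤ m) : (children G r v).card = d - 1 := by
  have hdv : 0 < G.dist r v := hr.pos_dist_of_ne hvr.symm
  obtain ⟨p, hp⟩ := hr.exists_walk_length_eq_dist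
  have hnil : ¬ p.Nil := by
    rw [← SimpleGraph.Walk.length_eq_zero_iff]
    omega
  set y := p.penultimate
  have hyv : G.Adj y v := p.adj_penultimate hnil
  have hry : G.Reachable r y := hr.trans hyv.symm.reachable
  have hy1 : G.dist r y + 1 ≤ G.dist r v := by
    have := SimpleGraph.dist_le p.dropLast
    have h2 : p.dropLast.length = p.length - 1 := by simp
    change G.dist r p.penultimate + 1 ≤ _
    omega
  have hy2 : G.dist r v ≤ G.dist r y + 1 := by
    obtain ⟨q, hq⟩ := hry.exists_walk_length_eq_dist
    have := SimpleGraph.dist_le (q.concat hyv)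
    rw [SimpleGraph.Walk.length_concat] at this
    omega
  have hchild : IsChild G r y v := ⟨hyv, by omega⟩
  have : children G r v = (G.neighborFinset v).erase y := by
    ext w
    rw [mem_children, Finset.mem_erase, SimpleGraph.mem_neighborFinset]
    constructor
    · intro h
      refine ⟨?_, h.1⟩
      rintro rfl
      have := h.2
      omega
    · rintro ⟨hwy, hvw⟩
      refine ⟨hvw, ?_⟩
      have hne := dist_ne_of_egirth hg (i := G.dist r v) (by omega) hr rfl hvw
      have h1 : G.dist r w ≤ G.dist r v + 1 := by
        obtain ⟨q, hq⟩ := hr.exists_walk_length_eq_dist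
        have := SimpleGraph.dist_le (q.concat hvw)
        rw [SimpleGraph.Walk.length_concat] at this
        omega
      have h2 : G.dist r v ≤ G.dist r w + 1 := by
        obtain ⟨q, hq⟩ := (hr.trans hvw.reachable).exists_walk_length_eq_dist
        have := SimpleGraph.dist_le (q.concat hvw.symm)
        rw [SimpleGraph.Walk.length_concat] at this
        omega
      by_contra h3
      have : IsChild G r w v := ⟨hvw.symm, by omega⟩
      exact hwy (this.unique hg hm hchild)
  rw [this, Finset.card_erase_of_mem (by simpa using hyv.symm),
    SimpleGraph.card_neighborFinset_eq_degree, hd v]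

end Children

section Survival

variable [Fintype V]

/-- The edges on which `Survives G T r n v` depends. -/
noncomputable def branchEdges (G : SimpleGraph V) (r : V) : ℕ → V → Finset (Sym2 V)
  | 0, _ => ∅
  | n + 1, v => (children G r v).biUnion fun w => insert s(v, w) (branchEdges G r n w)

theorem mem_branchEdges {n : ℕ} {v : V} {e : Sym2 V} (h : e ∈ branchEdges G r n v) :
    ∃ x y, e = s(x, y) ∧ IsChild G r x y ∧ G.dist r y ≤ G.dist r v + n ∧
      Relation.ReflTransGen (IsChild G r) v x := by
  induction n generalizing v with
  | zero => simp [branchEdges] at h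
  | succ n ih =>
    simp only [branchEdges, Finset.mem_biUnion, Finset.mem_insert, mem_children] at h
    obtain ⟨w, hw, rfl | h⟩ := h
    · exact ⟨v, w, rfl, hw, by have := hw.2; omega, .refl⟩
    · obtain ⟨x, y, he, hxy, hd, hx⟩ := ih h
      exact ⟨x, y, he, hxy, by have := hw.2; omega, hx.head hw⟩

theorem mem_insert_branchEdges {n : ℕ} {v w : V} {e : Sym2 V} (hw : IsChild G r v w)
    (h : e ∈ insert s(v, w) (branchEdges G r n w)) :
    ∃ x y, e = s(x, y) ∧ IsChild G r x y ∧ G.dist r y ≤ G.dist r w + n ∧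
      Relation.ReflTransGen (IsChild G r) w y := by
  rcases Finset.mem_insert.1 h with rfl | h
  · exact ⟨v, w, rfl, hw, by omega, .refl⟩
  · obtain ⟨x, y, he, hxy, hd, hx⟩ := mem_branchEdges h
    exact ⟨x, y, he, hxy, hd, hx.tail hxy⟩

/-- The lower end of a common edge would descend from both `w` and `w'`, which lie at the same
level. -/
theorem disjoint_branchEdges (hg : ((2 * (m + 1) : ℕ) : ℕ∞) < G.egirth) {n : ℕ} {v w w' : V}
    (hw : IsChild G r v w) (hw' : IsChild G r v w') (hne : w ≠ w')
    (hm : G.dist r v + (n + 1) ≤ m) :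
    Disjoint (insert s(v, w) (branchEdges G r n w)) (insert s(v, w') (branchEdges G r n w')) := by
  rw [Finset.disjoint_left]
  intro e he he'
  obtain ⟨x, y, rfl, hxy, hd, hy⟩ := mem_insert_branchEdges hw he
  obtain ⟨x', y', he, hxy', hd', hy'⟩ := mem_insert_branchEdges hw' he'
  obtain ⟨rfl, rfl⟩ := isChild_lower_unique he hxy hxy'
  have h1 := hw.2
  have h2 := hw'.2
  exact hne (ancestor_unique hg (by omega) hy hy' (by omega))

theorem notMem_branchEdges {n : ℕ} {v w : V} (hw : IsChild G r v w) :
    s(v, w) ∉ branchEdges G r n w := by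
  intro h
  obtain ⟨x, y, he, hxy, hd, hx⟩ := mem_branchEdges h
  obtain ⟨rfl, rfl⟩ := isChild_lower_unique he hw hxy
  have := dist_le_of_descendant hx
  have := hw.2
  omega

theorem survives_congr {n : ℕ} {v : V} {T T' : Finset (Sym2 V)}
    (h : T ∩ branchEdges G r n v = T' ∩ branchEdges G r n v) :
    Survives G T r n v ↔ Survives G T' r n v := by
  induction n generalizing v with
  | zero => rfl
  | succ n ih =>
    refine exists_congr fun w => and_congr_right fun hw => ?_
    have hsub : insert s(v, w) (branchEdges G r n w) ⊆ branchEdges G r (n + 1) v :=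
      Finset.subset_biUnion_of_mem (fun w => insert s(v, w) (branchEdges G r n w))
        (mem_children.2 hw)
    have hmem : ∀ e ∈ insert s(v, w) (branchEdges G r n w), (e ∈ T ↔ e ∈ T') := by
      intro e he
      have : e ∈ T ∩ branchEdges G r (n + 1) v ↔ e ∈ T' ∩ branchEdges G r (n + 1) v := by rw [h]
      simpa [hsub he] using this
    refine and_congr (hmem _ (by simp)) (ih ?_)
    ext e
    simp only [Finset.mem_inter]
    exact and_congr_left fun he => hmem e (by simp [he])

theorem dependsOnInter_survivalInd (n : ℕ) (v : V) :
    DependsOnInter (branchEdges G r n v) (survivalInd G r n v) := by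
  intro T T' h
  unfold survivalInd
  classical
  exact if_congr (survives_congr h) rfl rfl

open Classical in
-- Extinction means failure through every child. The product form prepares the use of independence.
theorem survivalInd_succ (n : ℕ) (v : V) (T : Finset (Sym2 V)) :
    survivalInd G r (n + 1) v T =
      1 - ∏ w ∈ children G r v, (1 - (if s(v, w) ∈ T then 1 else 0) * survivalInd G r n w T) := by
  have hfac : ∀ w, (1 - (if s(v, w) ∈ T then (1 : ℝ) else 0) * survivalInd G r n w T) =
      if ¬ (s(v, w) ∈ T ∧ Survives G T r n w) then 1 else 0 := by
    intro w
    unfold survivalInd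
    by_cases h1 : s(v, w) ∈ T <;> by_cases h2 : Survives G T r n w <;> simp [h1, h2]
  simp only [hfac]
  rw [Finset.prod_boole]
  unfold survivalInd
  by_cases h : Survives G T r (n + 1) v
  · rw [if_pos h, if_neg]
    · simp
    · obtain ⟨w, hw, h1, h2⟩ := h
      intro h3
      exact h3 w (mem_children.2 hw) ⟨h1, h2⟩
  · rw [if_neg h, if_pos]
    · simp
    · intro w hw h1
      exact h ⟨w, mem_children.1 hw, h1.1, h1.2⟩

variable [DecidableRel G.Adj]

/-- Different children use disjoint edge sets, and the edge to `w` is not among the edges below `w`.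
Both the product over children and each factor therefore split under the expectation. -/
theorem bernExp_survivalInd_succ (hg : ((2 * (m + 1) : ℕ) : ℕ∞) < G.egirth) {n : ℕ} {v : V}
    (hm : G.dist r v + (n + 1) ≤ m) (p : ℝ) :
    bernExp G.edgeFinset p (survivalInd G r (n + 1) v) =
      1 - ∏ w ∈ children G r v, (1 - p * bernExp G.edgeFinset p (survivalInd G r n w)) := by
  classical
  rw [bernExp_congr fun T _ => survivalInd_succ n v T, bernExp_one_sub]
  have hdep1 : ∀ w, DependsOnInter {s(v, w)}
      (fun T : Finset (Sym2 V) => if s(v, w) ∈ T then (1 : ℝ) else 0) := by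
    intro w T T' hT
    have : s(v, w) ∈ T ∩ {s(v, w)} ↔ s(v, w) ∈ T' ∩ {s(v, w)} := by rw [hT]
    simp only [Finset.mem_inter, Finset.mem_singleton, and_true] at this
    simp only [this]
  rw [bernExp_prod (s := children G r v)
    (f := fun w T => 1 - (if s(v, w) ∈ T then 1 else 0) * survivalInd G r n w T)
    (F := fun w => insert s(v, w) (branchEdges G r n w))]
  · congr 1
    refine Finset.prod_congr rfl fun w hw => ?_
    have hw := mem_children.1 hw
    rw [bernExp_one_sub, bernExp_mul p (hdep1 w) (dependsOnInter_survivalInd n w)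
      (by simpa using notMem_branchEdges hw),
      bernExp_mem p (e := s(v, w)) (SimpleGraph.mem_edgeFinset.2 hw.1)]
  · intro w hw T T' hT
    have h1 := (hdep1 w).mono (F' := insert s(v, w) (branchEdges G r n w))
      (Finset.singleton_subset_iff.2 (Finset.mem_insert_self _ _)) T T' hT
    have h2 := (dependsOnInter_survivalInd n w).mono
      (F' := insert s(v, w) (branchEdges G r n w)) (Finset.subset_insert _ _) T T' hT
    exact congrArg₂ (fun a b : ℝ => 1 - a * b) h1 h2
  · intro w hw w' hw' hne
    exact disjoint_branchEdges hg (mem_children.1 hw) (mem_children.1 hw') hne hm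

theorem bernExp_survivalInd_of_ne {d : ℕ} (hd : G.IsRegularOfDegree d)
    (hg : ((2 * (m + 1) : ℕ) : ℕ∞) < G.egirth) {n : ℕ} {v : V} (hr : G.Reachable r v)
    (hvr : v ≠ r) (hm : G.dist r v + n ≤ m) (p : ℝ) :
    bernExp G.edgeFinset p (survivalInd G r n v) = branchProb (d - 1) p n := by
  induction n generalizing v with
  | zero =>
    have : survivalInd G r 0 v = fun _ => 1 := by
      funext T
      simp [survivalInd, Survives]
    rw [this, bernExp_const, branchProb]
  | succ n ih =>
    rw [bernExp_survivalInd_succ hg hm, branchProb]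
    rw [Finset.prod_congr rfl fun w hw => ?_, Finset.prod_const,
      card_children hd hg hr hvr (by omega)]
    have hw := mem_children.1 hw
    rw [ih (hr.trans hw.1.reachable) ?_ (by have := hw.2; omega)]
    rintro rfl
    have := hw.2
    rw [SimpleGraph.dist_self] at this
    omega

theorem bernExp_survivalInd_root {d : ℕ} (hd : G.IsRegularOfDegree d)
    (hg : ((2 * (m + 1) : ℕ) : ℕ∞) < G.egirth) {n : ℕ} (hm : n + 1 ≤ m) (r : V) (p : ℝ) :
    bernExp G.edgeFinset p (survivalInd G r (n + 1) r) = rootProb d p n := by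
  rw [bernExp_survivalInd_succ hg (by simpa using hm), rootProb]
  rw [Finset.prod_congr rfl fun w hw => ?_, Finset.prod_const, card_children_root hd]
  have hw := mem_children.1 hw
  rw [bernExp_survivalInd_of_ne hd hg hw.1.reachable hw.1.ne.symm]
  have := hw.2
  rw [SimpleGraph.dist_self] at this
  omega

end Survival

end Descent

/-! ### Vertices with a long open descending path -/

section Survivors

variable {V : Type*} {G : SimpleGraph V} {m : ℕ}

theorem survives_of_descendant {T : Finset (Sym2 V)} {r v w : V} {n : ℕ}
    (h : Relation.ReflTransGen (fun a b => IsChild G r a b ∧ s(a, b) ∈ T) v w)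
    (hn : G.dist r w = G.dist r v + n) : Survives G T r n v := by
  induction h using Relation.ReflTransGen.head_induction_on generalizing n with
  | refl =>
    obtain rfl : n = 0 := by omega
    trivial
  | head h h' ih =>
    have h1 := h.1.2
    have h2 := dist_le_of_descendant (Relation.ReflTransGen.mono (fun _ _ h => h.1) _ _ h')
    obtain ⟨k, rfl⟩ : ∃ k, n = k + 1 := ⟨n - 1, by omega⟩
    exact ⟨_, h.1, h.2, ih (by omega)⟩

variable [Fintype V]

open Classical in
/-- The vertices `r` from which `T` contains a path of `m` edges moving away from `r`. -/
noncomputable def survivors (G : SimpleGraph V) (T : Finset (Sym2 V)) (m : ℕ) : Finset V :=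
  {r | Survives G T r m r}

theorem mem_survivors {T : Finset (Sym2 V)} {r : V} :
    r ∈ survivors G T m ↔ Survives G T r m r := by
  simp [survivors]

theorem survivors_mono {T T' : Finset (Sym2 V)} (h : T ⊆ T') :
    survivors G T m ⊆ survivors G T' m := by
  intro r hr
  exact mem_survivors.2 ((mem_survivors.1 hr).mono h)

theorem card_survivors (T : Finset (Sym2 V)) :
    ((survivors G T m).card : ℝ) = ∑ r, survivalInd G r m r T := by
  simp [survivors, survivalInd]

theorem exists_mem_walkBall_of_survives {T : Finset (Sym2 V)} {r v : V} {n : ℕ}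
    (h : Survives G T r n v) {j : ℕ} (hj : j ≤ n) :
    ∃ w ∈ walkBall (SimpleGraph.fromEdgeSet (T : Set (Sym2 V))) v j,
      G.dist r w = G.dist r v + j := by
  induction n generalizing v j with
  | zero =>
    obtain rfl : j = 0 := by omega
    exact ⟨v, self_mem_walkBall _ _ _, rfl⟩
  | succ n ih =>
    cases j with
    | zero => exact ⟨v, self_mem_walkBall _ _ _, rfl⟩
    | succ j =>
      obtain ⟨w, hw, hT, hs⟩ := h
      obtain ⟨x, hx, hd⟩ := ih hs (j := j) (by omega)
      obtain ⟨p, hp⟩ := mem_walkBall.1 hx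
      have hadj : (SimpleGraph.fromEdgeSet (T : Set (Sym2 V))).Adj v w :=
        (SimpleGraph.fromEdgeSet_adj _).2 ⟨by exact_mod_cast hT, hw.1.ne⟩
      refine ⟨x, mem_walkBall.2 ⟨.cons hadj p, by simpa using hp⟩, ?_⟩
      rw [hd, hw.2]
      ring

/-- A descending open path meets each of the distances `0, …, m` from `r`. -/
theorem card_walkBall_of_mem_survivors {T : Finset (Sym2 V)} {r : V}
    (h : r ∈ survivors G T m) :
    m + 1 ≤ (walkBall (SimpleGraph.fromEdgeSet (T : Set (Sym2 V))) r m).card := by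
  classical
  have hsub : Finset.range (m + 1) ⊆
      (walkBall (SimpleGraph.fromEdgeSet (T : Set (Sym2 V))) r m).image (G.dist r) := by
    intro j hj
    have hj : j ≤ m := by simpa [Nat.lt_succ_iff] using hj
    obtain ⟨w, hw, hd⟩ := exists_mem_walkBall_of_survives (mem_survivors.1 h) hj
    exact Finset.mem_image.2 ⟨w, walkBall_mono le_rfl hj _ hw, by simpa using hd⟩
  simpa using (Finset.card_le_card hsub).trans Finset.card_image_le

variable [DecidableEq V]

/-- If no open path leads from `r` to distance `m`, the cluster of `r` lies in a ball of radius `m`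
around `r`. -/
theorem reachable_subset_walkBall (hg : ((2 * (m + 1) : ℕ) : ℕ∞) < G.egirth)
    {T : Finset (Sym2 V)} (hT : (T : Set (Sym2 V)) ⊆ G.edgeSet) {r w : V}
    (hr : r ∉ survivors G T m)
    (hw : (SimpleGraph.fromEdgeSet (T : Set (Sym2 V))).Reachable r w) :
    w ∈ walkBall G r m := by
  have hm : m ≠ 0 := by
    rintro rfl
    exact hr (mem_survivors.2 trivial)
  -- Invariant along an open walk from `r`: the current vertex ends an open descending path and is
  -- at distance less than `m`. A step outward extends that path and cannot reach distance `m`, as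
  -- `r` would survive; a step inward must go to the unique parent, which is the previous vertex of
  -- that path.
  have key : Relation.ReflTransGen (fun a b => IsChild G r a b ∧ s(a, b) ∈ T) r w ∧
      G.dist r w < m := by
    rw [SimpleGraph.reachable_iff_reflTransGen] at hw
    induction hw with
    | refl => exact ⟨.refl, by rw [SimpleGraph.dist_self]; omega⟩
    | @tail x y _ hxy ih =>
      obtain ⟨hx, hxm⟩ := ih
      obtain ⟨hxyT, hne⟩ := (SimpleGraph.fromEdgeSet_adj _).1 hxy
      have hxyG : G.Adj x y := hT hxyT
      have hrx : G.Reachable r x := by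
        rw [SimpleGraph.reachable_iff_reflTransGen]
        exact Relation.ReflTransGen.mono (fun _ _ h => h.1.1) _ _ hx
      have h1 : G.dist r y ≤ G.dist r x + 1 := by
        obtain ⟨q, hq⟩ := hrx.exists_walk_length_eq_dist
        have := SimpleGraph.dist_le (q.concat hxyG)
        rw [SimpleGraph.Walk.length_concat] at this
        omega
      have h2 : G.dist r x ≤ G.dist r y + 1 := by
        obtain ⟨q, hq⟩ := (hrx.trans hxyG.reachable).exists_walk_length_eq_dist
        have := SimpleGraph.dist_le (q.concat hxyG.symm)
        rw [SimpleGraph.Walk.length_concat] at this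
        omega
      have h3 := dist_ne_of_egirth hg (i := G.dist r x) (by omega) hrx rfl hxyG
      rcases (by omega : G.dist r y = G.dist r x + 1 ∨ G.dist r x = G.dist r y + 1) with h | h
      · have hy := hx.tail (c := y) ⟨⟨hxyG, h⟩, by exact_mod_cast hxyT⟩
        refine ⟨hy, lt_of_le_of_ne (by omega) fun hym => hr (mem_survivors.2 ?_)⟩
        exact survives_of_descendant hy (by rw [SimpleGraph.dist_self]; omega)
      · cases hx with
        | refl => rw [SimpleGraph.dist_self] at h; omega
        | @tail z _ hz hzx =>
          obtain rfl := hzx.1.unique hg (by omega) ⟨hxyG.symm, h⟩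
          exact ⟨hz, by omega⟩
  have hrw : G.Reachable r w := by
    rw [SimpleGraph.reachable_iff_reflTransGen]
    exact Relation.ReflTransGen.mono (fun _ _ h => h.1.1) _ _ key.1
  obtain ⟨q, hq⟩ := hrw.exists_walk_length_eq_dist
  exact mem_walkBall.2 ⟨q, by omega⟩

theorem mem_walkBall_of_mem_branchEdges {r x y : V} (h : s(x, y) ∈ branchEdges G r m r) :
    r ∈ walkBall G x m ∪ walkBall G y m := by
  obtain ⟨x', y', he, hxy, hd, -⟩ := mem_branchEdges h
  rw [SimpleGraph.dist_self] at hd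
  obtain ⟨q, hq⟩ := hxy.reachable.exists_walk_length_eq_dist
  have h1 : x' ∈ walkBall G r m := mem_walkBall.2 ⟨q, by have := hxy.2; omega⟩
  have h2 := mem_walkBall_symm h1
  rcases Sym2.eq_iff.1 he with ⟨rfl, rfl⟩ | ⟨rfl, rfl⟩
  · exact Finset.mem_union_left _ h2
  · exact Finset.mem_union_right _ h2

variable [DecidableRel G.Adj]

/-- Changing one edge affects only roots within distance `m` of one of its two ends. -/
theorem abs_card_survivors_insert_sub_le {d : ℕ} (hd : ∀ v, G.degree v ≤ d)
    (T : Finset (Sym2 V)) (e : Sym2 V) :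
    |((survivors G (insert e T) m).card : ℝ) - (survivors G T m).card| ≤ 2 * (d + 1) ^ m := by
  classical
  induction e using Sym2.ind with
  | _ x y =>
  rw [card_survivors, card_survivors, ← Finset.sum_sub_distrib]
  set B := walkBall G x m ∪ walkBall G y m
  have hB : (B.card : ℝ) ≤ 2 * (d + 1) ^ m := by
    have h1 : B.card ≤ 2 * (d + 1) ^ m := by
      refine (Finset.card_union_le _ _).trans ?_
      have := card_walkBall_le hd x m
      have := card_walkBall_le hd y m
      omega
    exact_mod_cast h1
  calc _ ≤ ∑ r, |survivalInd G r m r (insert s(x, y) T) - survivalInd G r m r T| :=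
        Finset.abs_sum_le_sum_abs _ _
    _ ≤ ∑ r, if r ∈ B then (1 : ℝ) else 0 := by
        refine Finset.sum_le_sum fun r _ => ?_
        split_ifs with h
        · unfold survivalInd
          split_ifs <;> norm_num
        · rw [(dependsOnInter_survivalInd m r).insert_eq fun h' =>
            h (mem_walkBall_of_mem_branchEdges h')]
          simp
    _ = B.card := by simp
    _ ≤ _ := hB

theorem bernExp_card_survivors {d : ℕ} (hd : G.IsRegularOfDegree d) {n : ℕ}
    (hg : ((2 * (n + 1 + 1) : ℕ) : ℕ∞) < G.egirth) (p : ℝ) :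
    bernExp G.edgeFinset p (fun T => ((survivors G T (n + 1)).card : ℝ)) =
      Fintype.card V * rootProb d p n := by
  simp only [card_survivors]
  rw [bernExp_sum]
  rw [Finset.sum_congr rfl fun r _ => bernExp_survivalInd_root hd hg le_rfl r p]
  simp

end Survivors

/-! ### Edge cuts and expansion -/

section Cuts

variable {V : Type*}

open Classical in
/-- The elements of `T` joining `W` to its complement. -/
noncomputable def cut (T : Finset (Sym2 V)) (W : Finset V) : Finset (Sym2 V) :=
  {e ∈ T | ∃ x ∈ W, ∃ y ∉ W, e = s(x, y)}

theorem mem_cut {T : Finset (Sym2 V)} {W : Finset V} {e : Sym2 V} :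
    e ∈ cut T W ↔ e ∈ T ∧ ∃ x ∈ W, ∃ y ∉ W, e = s(x, y) := by
  simp [cut]

theorem cut_mono {T T' : Finset (Sym2 V)} (h : T ⊆ T') (W : Finset V) : cut T W ⊆ cut T' W := by
  intro e he
  obtain ⟨h1, h2⟩ := mem_cut.1 he
  exact mem_cut.2 ⟨h h1, h2⟩

theorem mem_cut_of_not_iff {T : Finset (Sym2 V)} {W : Finset V} {x y : V} (h : s(x, y) ∈ T)
    (hxy : ¬ (x ∈ W ↔ y ∈ W)) : s(x, y) ∈ cut T W := by
  by_cases hx : x ∈ W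
  · exact mem_cut.2 ⟨h, x, hx, y, fun hy => hxy (by simp [hx, hy]), rfl⟩
  · exact mem_cut.2 ⟨h, y, by by_contra hy; exact hxy (by simp [hx, hy]), x, hx, Sym2.eq_swap⟩

theorem cut_compl [Fintype V] [DecidableEq V] (T : Finset (Sym2 V)) (W : Finset V) :
    cut T Wᶜ = cut T W := by
  ext e
  induction e using Sym2.ind with
  | _ x y =>
  simp only [mem_cut, Finset.mem_compl, not_not]
  refine and_congr_right fun _ => ⟨?_, ?_⟩
  · rintro ⟨a, ha, b, hb, h⟩
    exact ⟨b, hb, a, ha, h.trans Sym2.eq_swap⟩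
  · rintro ⟨a, ha, b, hb, h⟩
    exact ⟨b, hb, a, ha, h.trans Sym2.eq_swap⟩

/-- Expansion is applied to the smaller of `W` and `Wᶜ`, whose cuts coincide. -/
theorem IsExpander.le_card_cut [Fintype V] [DecidableEq V] {G : SimpleGraph V}
    [DecidableRel G.Adj] {b : ℝ} {d : ℕ} (hG : IsExpander G b d) (hb : 0 ≤ b) {W : Finset V}
    {t : ℝ} (h1 : t ≤ W.card) (h2 : t ≤ Wᶜ.card) : b * t ≤ (cut G.edgeFinset W).card := by
  have key : ∀ S : Finset V, (G.interedges S Sᶜ).card ≤ (cut G.edgeFinset S).card := by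
    intro S
    refine Finset.card_le_card_of_injOn (fun q => s(q.1, q.2)) ?_ ?_
    · rintro ⟨x, y⟩ hq
      obtain ⟨hx, hy, hxy⟩ := (SimpleGraph.mem_interedges_iff G).1 hq
      exact mem_cut.2 ⟨SimpleGraph.mem_edgeFinset.2 hxy, x, hx, y, by simpa using hy, rfl⟩
    · rintro ⟨x, y⟩ hq ⟨x', y'⟩ hq' h
      obtain ⟨hx, hy, -⟩ := (SimpleGraph.mem_interedges_iff G).1 hq
      obtain ⟨hx', hy', -⟩ := (SimpleGraph.mem_interedges_iff G).1 hq'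
      rcases Sym2.eq_iff.1 h with ⟨rfl, rfl⟩ | ⟨rfl, rfl⟩
      · rfl
      · exact absurd hx' (by simpa using hy)
  have hsum : (W.card : ℝ) + Wᶜ.card = Fintype.card V := by
    exact_mod_cast Finset.card_add_card_compl W
  rcases le_total (W.card : ℝ) (Wᶜ.card : ℝ) with h | h
  · calc b * t ≤ b * W.card := mul_le_mul_of_nonneg_left h1 hb
      _ ≤ _ := hG.2 W (by linarith)
      _ ≤ _ := by exact_mod_cast key W
  · calc b * t ≤ b * Wᶜ.card := mul_le_mul_of_nonneg_left h2 hb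
      _ ≤ _ := hG.2 Wᶜ (by linarith)
      _ ≤ (cut G.edgeFinset Wᶜ).card := by exact_mod_cast key Wᶜ
      _ = _ := by rw [cut_compl]

end Cuts

/-! ### Nets in the large clusters -/

section Nets

variable {V : Type*} [Fintype V]

theorem exists_mem_cut_of_walk {T : Finset (Sym2 V)} {W : Finset V} {v u : V}
    (p : (SimpleGraph.fromEdgeSet (T : Set (Sym2 V))).Walk v u) (h : ¬ (v ∈ W ↔ u ∈ W)) :
    ∃ e ∈ cut T W, ∃ x ∈ e,
      x ∈ walkBall (SimpleGraph.fromEdgeSet (T : Set (Sym2 V))) v p.length := by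
  induction p with
  | nil => exact absurd Iff.rfl h
  | @cons v w u hvw q ih =>
    by_cases hvW : v ∈ W ↔ w ∈ W
    · obtain ⟨e, he, x, hx, hb⟩ := ih (by rwa [← hvW])
      obtain ⟨q', hq'⟩ := mem_walkBall.1 hb
      exact ⟨e, he, x, hx, mem_walkBall.2 ⟨.cons hvw q', by simpa using hq'⟩⟩
    · have hT : s(v, w) ∈ T := by exact_mod_cast ((SimpleGraph.fromEdgeSet_adj _).1 hvw).1
      exact ⟨_, mem_cut_of_not_iff hT hvW, v, by simp, self_mem_walkBall _ _ _⟩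

/-- If every vertex of `M` has at least `k` vertices of its `T`-cluster within distance `i`, then
`M` can be mapped to a set of at most `|V| / k` vertices in such a way that every set `W` separates
few vertices from their images, in terms of the number of edges of `T` in the cut of `W`. -/
theorem exists_net {G : SimpleGraph V} [DecidableRel G.Adj] {d : ℕ} (hd : ∀ v, G.degree v ≤ d)
    {T : Finset (Sym2 V)} (hT : (T : Set (Sym2 V)) ⊆ G.edgeSet) {M : Finset V} {i k : ℕ}
    (hM : ∀ v ∈ M, k ≤ (walkBall (SimpleGraph.fromEdgeSet (T : Set (Sym2 V))) v i).card) :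
    ∃ (N : Finset V) (a : V → V), N.card * k ≤ Fintype.card V ∧ (∀ v ∈ M, a v ∈ N) ∧
      ∀ W : Finset V, ∀ B : Finset V, (∀ v ∈ B, v ∈ M ∧ ¬ (v ∈ W ↔ a v ∈ W)) →
        B.card ≤ (cut T W).card * (2 * (d + 1) ^ (2 * i)) := by
  classical
  set H := SimpleGraph.fromEdgeSet (T : Set (Sym2 V)) with hH
  have hHG : H ≤ G := by
    intro x y hxy
    exact hT ((SimpleGraph.fromEdgeSet_adj _).1 hxy).1
  -- A maximal set of centres in `M` with disjoint `H`-balls of radius `i`. Disjointness bounds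
  -- `N.card * k`; maximality puts every vertex of `M` within `2 * i` of `N`.
  obtain ⟨N, hN, hmax⟩ := Finset.exists_max_image
    (M.powerset.filter fun N : Finset V => (N : Set V).PairwiseDisjoint fun v => walkBall H v i) Finset.card
    ⟨∅, by simp⟩
  obtain ⟨hNM, hdisj⟩ := Finset.mem_filter.1 hN
  rw [Finset.mem_powerset] at hNM
  have hclose : ∀ v ∈ M, ∃ u ∈ N, u ∈ walkBall H v (2 * i) := by
    intro v hv
    by_contra! hcon
    have hdv : ∀ u ∈ N, Disjoint (walkBall H v i) (walkBall H u i) := by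
      intro u hu
      rw [Finset.disjoint_left]
      intro x hx hx'
      have := mem_walkBall_trans hx (mem_walkBall_symm hx')
      rw [← two_mul] at this
      exact hcon u hu this
    have hvN : v ∉ N := fun h => hcon v h (self_mem_walkBall _ _ _)
    have hmem : insert v N ∈ M.powerset.filter fun N : Finset V =>
        (N : Set V).PairwiseDisjoint fun v => walkBall H v i := by
      rw [Finset.mem_filter, Finset.mem_powerset]
      refine ⟨Finset.insert_subset hv hNM, ?_⟩
      rw [Finset.coe_insert]
      exact hdisj.insert fun u hu _ => hdv u hu
    have := hmax _ hmem
    rw [Finset.card_insert_of_notMem hvN] at this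
    omega
  choose! a haN hab using hclose
  refine ⟨N, a, ?_, haN, ?_⟩
  · calc N.card * k ≤ ∑ v ∈ N, (walkBall H v i).card := by
          rw [← smul_eq_mul]
          exact Finset.card_nsmul_le_sum _ _ _ fun v hv => hM v (hNM hv)
      _ = (N.biUnion fun v => walkBall H v i).card := (Finset.card_biUnion hdisj).symm
      _ ≤ _ := Finset.card_le_univ _
  · intro W B hB
    -- The open walk from a displaced `v` to `a v` crosses the cut, so `v` is within `2 * i` of an
    -- end of a cut edge.
    have hsub : B ⊆ (cut T W).biUnion fun e => e.toFinset.biUnion fun x => walkBall G x (2 * i) := by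
      intro v hv
      obtain ⟨hvM, hvW⟩ := hB v hv
      obtain ⟨p, hp⟩ := mem_walkBall.1 (hab v hvM)
      obtain ⟨e, he, x, hx, hxb⟩ := exists_mem_cut_of_walk p hvW
      refine Finset.mem_biUnion.2 ⟨e, he, Finset.mem_biUnion.2 ⟨x, by simpa using hx, ?_⟩⟩
      exact mem_walkBall_symm (walkBall_mono hHG hp v hxb)
    refine (Finset.card_le_card hsub).trans (Finset.card_biUnion_le_card_mul _ _ _ fun e _ => ?_)
    refine (Finset.card_biUnion_le_card_mul _ _ _ fun x _ => card_walkBall_le hd x (2 * i)).trans ?_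
    refine Nat.mul_le_mul_right _ ?_
    induction e using Sym2.ind with
    | _ x y =>
      rw [Sym2.toFinset_mk_eq]
      exact Finset.card_le_two

end Nets

/-! ### Edge-disjoint short connections -/

section Crossings

variable {V : Type*}

/-- `P` meets the cut of every set separating `X` from `Y`. -/
def Crosses (X Y : Finset V) (P : Finset (Sym2 V)) : Prop :=
  ∀ W : Finset V, X ⊆ W → Disjoint W Y → (cut P W).Nonempty

variable [Fintype V] [DecidableEq V]

/-- The vertices at distance at most `i` from `X` in the graph with edge set `E`. -/
noncomputable def grow (E : Finset (Sym2 V)) (X : Finset V) : ℕ → Finset V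
  | 0 => X
  | i + 1 => grow E X i ∪ Finset.univ.filter fun w => ∃ v ∈ grow E X i, s(v, w) ∈ E

theorem grow_mono (E : Finset (Sym2 V)) (X : Finset V) : Monotone (grow E X) :=
  monotone_nat_of_le_succ fun _ => Finset.subset_union_left

theorem exists_subset_of_mem_grow {E : Finset (Sym2 V)} {X : Finset V} {i : ℕ} {v : V}
    (hv : v ∈ grow E X i) :
    ∃ P ⊆ E, P.card ≤ i ∧ ∀ W, X ⊆ W → v ∉ W → (cut P W).Nonempty := by
  induction i generalizing v with
  | zero => exact ⟨∅, by simp, by simp, fun W hW hvW => absurd (hW hv) hvW⟩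
  | succ i ih =>
    rcases Finset.mem_union.1 hv with hv | hv
    · obtain ⟨P, hP, hc, h⟩ := ih hv
      exact ⟨P, hP, by omega, h⟩
    · obtain ⟨-, u, hu, huv⟩ := Finset.mem_filter.1 hv
      obtain ⟨P, hP, hc, h⟩ := ih hu
      refine ⟨insert s(u, v) P, Finset.insert_subset huv hP,
        (Finset.card_insert_le _ _).trans (by omega), fun W hW hvW => ?_⟩
      by_cases huW : u ∈ W
      · exact ⟨_, mem_cut_of_not_iff (Finset.mem_insert_self _ _) (by simp [huW, hvW])⟩
      · exact (h W hW huW).mono (cut_mono (Finset.subset_insert _ _) W)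

/-- An edge leaving the `i`-th layer has both ends in every later layer. -/
theorem disjoint_cut_grow (E : Finset (Sym2 V)) (X : Finset V) {i j : ℕ} (hij : i < j) :
    Disjoint (cut E (grow E X i)) (cut E (grow E X j)) := by
  rw [Finset.disjoint_left]
  intro e he he'
  obtain ⟨heE, x, hx, y, -, rfl⟩ := mem_cut.1 he
  obtain ⟨-, x', -, y', hy', h⟩ := mem_cut.1 he'
  have hsub : grow E X (i + 1) ⊆ grow E X j := grow_mono E X hij
  have h1 : x ∈ grow E X j := hsub (Finset.mem_union_left _ hx)
  have h2 : y ∈ grow E X j :=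
    hsub (Finset.mem_union_right _ (Finset.mem_filter.2 ⟨Finset.mem_univ _, x, hx, heE⟩))
  rcases Sym2.eq_iff.1 h with ⟨rfl, rfl⟩ | ⟨rfl, rfl⟩
  · exact hy' h2
  · exact hy' h1

/-- If every cut between `X` and `Y` is large, there are many edge-disjoint short connections
between `X` and `Y`. -/
theorem exists_disjoint_crossings {E : Finset (Sym2 V)} {X Y : Finset V} (hXY : Disjoint X Y)
    {β : ℝ} (hβ : ∀ W, X ⊆ W → Disjoint W Y → β ≤ (cut E W).card) (L : ℕ) :
    ∃ K : Finset (Finset (Sym2 V)), (∀ P ∈ K, P ⊆ E ∧ P.card ≤ L ∧ Crosses X Y P) ∧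
      (K : Set (Finset (Sym2 V))).PairwiseDisjoint id ∧
      L * β ≤ E.card + L * (L * K.card) := by
  classical
  -- Take a maximal disjoint family and let `F` be its union. By maximality, growing `X` inside `E \
  -- F` does not meet `Y` within `L` steps. The cuts of the first `L` layers are disjoint, and each
  -- has at least `β - |F|` edges of `E \ F`; their sum is at most `|E|`.
  obtain ⟨K, hK, hmax⟩ := Finset.exists_max_image
    (E.powerset.powerset.filter fun K : Finset (Finset (Sym2 V)) => (∀ P ∈ K, P ⊆ E ∧ P.card ≤ L ∧ Crosses X Y P) ∧
      (K : Set (Finset (Sym2 V))).PairwiseDisjoint id) Finset.card ⟨∅, by simp⟩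
  obtain ⟨hsub, hP, hdisj⟩ := Finset.mem_filter.1 hK
  rw [Finset.mem_powerset] at hsub
  refine ⟨K, hP, hdisj, ?_⟩
  set F := K.biUnion id with hF
  have hFcard : (F.card : ℝ) ≤ L * K.card := by
    have : F.card ≤ K.card * L := Finset.card_biUnion_le_card_mul _ _ _ fun P h => (hP P h).2.1
    rw [mul_comm]
    exact_mod_cast this
  have hno : ∀ P ⊆ E \ F, P.card ≤ L → ¬ Crosses X Y P := by
    intro P hPE hPL hPc
    have hPF : Disjoint P F := Finset.disjoint_of_subset_left hPE Finset.sdiff_disjoint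
    have hPK : P ∉ K := by
      intro h
      have h1 : P ⊆ F := Finset.subset_biUnion_of_mem id h
      obtain ⟨e, he⟩ := hPc X subset_rfl hXY
      have heP := (mem_cut.1 he).1
      exact Finset.disjoint_left.1 hPF heP (h1 heP)
    have hPE' : P ⊆ E := hPE.trans Finset.sdiff_subset
    have := hmax (insert P K) (by
      refine Finset.mem_filter.2 ⟨?_, ?_, ?_⟩
      · exact Finset.mem_powerset.2 (Finset.insert_subset (Finset.mem_powerset.2 hPE') hsub)
      · intro Q hQ
        rcases Finset.mem_insert.1 hQ with rfl | hQ
        · exact ⟨hPE', hPL, hPc⟩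
        · exact hP Q hQ
      · rw [Finset.coe_insert]
        exact hdisj.insert fun Q hQ _ =>
          Finset.disjoint_of_subset_right (Finset.subset_biUnion_of_mem id hQ) hPF)
    rw [Finset.card_insert_of_notMem hPK] at this
    omega
  have hB : ∀ i ≤ L, Disjoint (grow (E \ F) X i) Y := by
    intro i hi
    rw [Finset.disjoint_left]
    intro y hy hyY
    obtain ⟨P, hPE, hPc, h⟩ := exists_subset_of_mem_grow hy
    exact hno P hPE (hPc.trans hi) fun W hW hWY =>
      h W hW fun hyW => Finset.disjoint_left.1 hWY hyW hyY
  have hcut : ∀ i ∈ Finset.range L, β ≤ (cut (E \ F) (grow (E \ F) X i)).card + F.card := by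
    intro i hi
    have h1 := hβ (grow (E \ F) X i) (grow_mono (E \ F) X (Nat.zero_le i))
      (hB i (Finset.mem_range.1 hi).le)
    have h2 : (cut E (grow (E \ F) X i)) ⊆ cut (E \ F) (grow (E \ F) X i) ∪ F := by
      intro e he
      obtain ⟨heE, h⟩ := mem_cut.1 he
      by_cases heF : e ∈ F
      · exact Finset.mem_union_right _ heF
      · exact Finset.mem_union_left _ (mem_cut.2 ⟨Finset.mem_sdiff.2 ⟨heE, heF⟩, h⟩)
    have h3 := (Finset.card_le_card h2).trans (Finset.card_union_le _ _)
    exact h1.trans (by exact_mod_cast h3)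
  have hsum : ∑ i ∈ Finset.range L, (cut (E \ F) (grow (E \ F) X i)).card ≤ E.card := by
    rw [← Finset.card_biUnion]
    · refine Finset.card_le_card (Finset.biUnion_subset.2 fun i _ e he => ?_)
      exact Finset.sdiff_subset (mem_cut.1 he).1
    · intro i _ j _ hij
      rcases lt_or_gt_of_ne hij with h | h
      · exact disjoint_cut_grow _ _ h
      · exact (disjoint_cut_grow _ _ h).symm
  calc L * β = ∑ i ∈ Finset.range L, β := by simp
    _ ≤ ∑ i ∈ Finset.range L, (((cut (E \ F) (grow (E \ F) X i)).card : ℝ) + F.card) :=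
      Finset.sum_le_sum hcut
    _ = ((∑ i ∈ Finset.range L, (cut (E \ F) (grow (E \ F) X i)).card : ℕ) : ℝ) + L * F.card := by
      rw [Finset.sum_add_distrib]
      simp
    _ ≤ E.card + L * (L * K.card) :=
      add_le_add (by exact_mod_cast hsum) (mul_le_mul_of_nonneg_left hFcard (by positivity))

end Crossings

/-! ### Tail bounds at linear scale and counts of open connections -/

section LinearTails

variable {α : Type*} [DecidableEq α]

/-- The exponential rate in the tail bounds for deviations of linear size. -/
noncomputable def tailRate (d c σ : ℝ) : ℝ := min (1 / c) (σ / (2 * d * c ^ 2)) * (σ / 2)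

theorem tailRate_pos {d c σ : ℝ} (hd : 0 < d) (hc : 0 < c) (hσ : 0 < σ) : 0 < tailRate d c σ := by
  unfold tailRate
  positivity

/-- The bound `l ≤ σ / (2 * d * c ^ 2)` makes the quadratic term at most half of the linear one; `1
/ c` in the minimum is the range where the moment bound is valid. -/
theorem exponent_le_tailRate {d c σ n k : ℝ} (hd : 0 < d) (hc : 0 < c) (hσ : 0 < σ)
    (hn : 0 ≤ n) (hk : k ≤ d * n) :
    -(min (1 / c) (σ / (2 * d * c ^ 2)) * (σ * n)) + k * (min (1 / c) (σ / (2 * d * c ^ 2)) * c) ^ 2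
      ≤ -tailRate d c σ * n := by
  unfold tailRate
  set l := min (1 / c) (σ / (2 * d * c ^ 2))
  have hl0 : 0 ≤ l := by positivity
  have hl : l * (2 * d * c ^ 2) ≤ σ := by
    rw [← le_div_iff₀ (by positivity)]
    exact min_le_right _ _
  have h1 : k * (l * c) ^ 2 ≤ d * n * (l * c) ^ 2 := mul_le_mul_of_nonneg_right hk (sq_nonneg _)
  have h2 : l * n * (l * (2 * d * c ^ 2)) ≤ l * n * σ :=
    mul_le_mul_of_nonneg_left hl (mul_nonneg hl0 hn)
  linarith

open Classical in
theorem bernExp_upper_tail_linear {E : Finset α} {p c d σ n : ℝ} (hp0 : 0 ≤ p) (hp1 : p ≤ 1)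
    (hd : 0 < d) (hc : 0 < c) (hσ : 0 < σ) (hn : 0 ≤ n) (hE : (E.card : ℝ) ≤ d * n)
    {f : Finset α → ℝ} (hf : ∀ T ⊆ E, ∀ e ∈ E, |f (insert e T) - f T| ≤ c) :
    bernExp E p (fun T => if bernExp E p f + σ * n ≤ f T then 1 else 0)
      ≤ Real.exp (-tailRate d c σ * n) := by
  refine (bernExp_upper_tail hp0 hp1 (l := min (1 / c) (σ / (2 * d * c ^ 2))) (by positivity) ?_
    hf).trans (Real.exp_le_exp.2 (exponent_le_tailRate hd hc hσ hn hE))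
  rw [← le_div_iff₀ hc]
  exact min_le_left _ _

open Classical in
theorem bernExp_lower_tail_linear {E : Finset α} {p c d σ n : ℝ} (hp0 : 0 ≤ p) (hp1 : p ≤ 1)
    (hd : 0 < d) (hc : 0 < c) (hσ : 0 < σ) (hn : 0 ≤ n) (hE : (E.card : ℝ) ≤ d * n)
    {f : Finset α → ℝ} (hf : ∀ T ⊆ E, ∀ e ∈ E, |f (insert e T) - f T| ≤ c) :
    bernExp E p (fun T => if f T ≤ bernExp E p f - σ * n then 1 else 0)
      ≤ Real.exp (-tailRate d c σ * n) := by
  refine (bernExp_lower_tail hp0 hp1 (l := min (1 / c) (σ / (2 * d * c ^ 2))) (by positivity) ?_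
    hf).trans (Real.exp_le_exp.2 (exponent_le_tailRate hd hc hσ hn hE))
  rw [← le_div_iff₀ hc]
  exact min_le_left _ _

open Classical in
/-- The number of sets of a disjoint family contained in `T`. -/
noncomputable def openCount (K : Finset (Finset α)) (T : Finset α) : ℝ :=
  ∑ P ∈ K, if P ⊆ T then 1 else 0

theorem le_bernExp_openCount {E : Finset α} {K : Finset (Finset α)} {L : ℕ} {q : ℝ}
    (hq0 : 0 ≤ q) (hq1 : q ≤ 1) (hK : ∀ P ∈ K, P ⊆ E ∧ P.card ≤ L) :
    K.card * q ^ L ≤ bernExp E q (openCount K) := by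
  unfold openCount
  rw [bernExp_sum, ← nsmul_eq_mul]
  refine Finset.card_nsmul_le_sum _ _ _ fun P hP => ?_
  rw [bernExp_subset q (hK P hP).1]
  exact pow_le_pow_of_le_one hq0 hq1 (hK P hP).2

/-- By disjointness, `e` belongs to at most one member of `K`. -/
theorem abs_openCount_insert_sub_le {K : Finset (Finset α)}
    (hK : (K : Set (Finset α)).PairwiseDisjoint id) (T : Finset α) (e : α) :
    |openCount K (insert e T) - openCount K T| ≤ 1 := by
  classical
  unfold openCount
  rw [← Finset.sum_sub_distrib]
  have hterm : ∀ P ∈ K, |(if P ⊆ insert e T then (1 : ℝ) else 0) - if P ⊆ T then 1 else 0| ≤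
      if e ∈ P then 1 else 0 := by
    intro P _
    by_cases he : e ∈ P
    · rw [if_pos he]
      split_ifs <;> norm_num
    · have : P ⊆ insert e T ↔ P ⊆ T := Finset.subset_insert_iff_of_notMem he
      simp [he, this]
  refine (Finset.abs_sum_le_sum_abs _ _).trans ((Finset.sum_le_sum hterm).trans ?_)
  rw [← Finset.sum_filter, Finset.sum_const, nsmul_eq_mul, mul_one]
  have : (K.filter fun P => e ∈ P).card ≤ 1 := by
    refine Finset.card_le_one.2 fun P hP Q hQ => ?_
    obtain ⟨hP, heP⟩ := Finset.mem_filter.1 hP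
    obtain ⟨hQ, heQ⟩ := Finset.mem_filter.1 hQ
    by_contra hne
    exact Finset.disjoint_left.1 (hK hP hQ hne) heP heQ
  exact_mod_cast this

/-- Each open member of `K` contributes an edge to the cut, and disjoint members contribute distinct
edges. -/
theorem openCount_le_card_cut {V : Type*} [DecidableEq V] {K : Finset (Finset (Sym2 V))}
    (hK : (K : Set (Finset (Sym2 V))).PairwiseDisjoint id) {X Y W : Finset V}
    (hc : ∀ P ∈ K, Crosses X Y P) (hXW : X ⊆ W) (hWY : Disjoint W Y) (T : Finset (Sym2 V)) :
    openCount K T ≤ (cut T W).card := by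
  classical
  unfold openCount
  rw [← Finset.sum_filter, Finset.sum_const, nsmul_eq_mul, mul_one]
  have hne : ∀ P, ∃ e : Option (Sym2 V), P ∈ K → ∃ e' ∈ cut P W, e = some e' := by
    intro P
    by_cases hP : P ∈ K
    · obtain ⟨e, he⟩ := hc P hP W hXW hWY
      exact ⟨some e, fun _ => ⟨e, he, rfl⟩⟩
    · exact ⟨none, fun h => absurd h hP⟩
  choose g hg using hne
  have : (K.filter fun P => P ⊆ T).card ≤ (cut T W).card := by
    rw [← Finset.card_map (s := cut T W) Function.Embedding.some]
    refine Finset.card_le_card_of_injOn g ?_ ?_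
    · intro P hP
      obtain ⟨hP, hPT⟩ := Finset.mem_filter.1 hP
      obtain ⟨e, he, hge⟩ := hg P hP
      exact Finset.mem_map.2 ⟨e, cut_mono hPT W he, hge.symm⟩
    · intro P hP Q hQ h
      obtain ⟨hP, -⟩ := Finset.mem_filter.1 hP
      obtain ⟨hQ, -⟩ := Finset.mem_filter.1 hQ
      by_contra hne
      obtain ⟨e, he, hge⟩ := hg P hP
      obtain ⟨e', he', hge'⟩ := hg Q hQ
      obtain rfl : e = e' := Option.some_injective _ (by rw [← hge, ← hge', h])
      exact Finset.disjoint_left.1 (hK hP hQ hne) (mem_cut.1 he).1 (mem_cut.1 he').1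
  exact_mod_cast this

open Classical in
theorem bernExp_exists_le {ι : Type*} (s : Finset ι) {E : Finset α} {p : ℝ} (hp0 : 0 ≤ p)
    (hp1 : p ≤ 1) (A : ι → Finset α → Prop) :
    bernExp E p (fun T => if ∃ i ∈ s, A i T then 1 else 0) ≤
      ∑ i ∈ s, bernExp E p (fun T => if A i T then 1 else 0) := by
  rw [← bernExp_sum]
  refine bernExp_mono hp0 hp1 fun T _ => ?_
  split_ifs with h
  · obtain ⟨i, hi, hA⟩ := h
    refine le_trans (by rw [if_pos hA])
      (Finset.single_le_sum (f := fun i => if A i T then (1 : ℝ) else 0) (fun j _ => ?_) hi)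
    positivity
  · exact Finset.sum_nonneg fun j _ => by positivity

end LinearTails

/-! ### Sprinkling and the union bound over the net -/

section Sprinkling

theorem card_edgeFinset_le {V : Type*} [Fintype V] [DecidableEq V] {G : SimpleGraph V}
    [DecidableRel G.Adj] {d : ℕ} (hd : ∀ v, G.degree v ≤ d) :
    (G.edgeFinset.card : ℝ) ≤ d * Fintype.card V := by
  have h1 := G.sum_degrees_eq_twice_card_edges
  have h2 : ∑ v, G.degree v ≤ Fintype.card V * d := by
    simpa using Finset.sum_le_card_nsmul Finset.univ (fun v => G.degree v) d fun v _ => hd v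
  have h3 : G.edgeFinset.card ≤ d * Fintype.card V := by
    rw [mul_comm d]
    omega
  exact_mod_cast h3

open Classical in
/-- In a percolated expander it is exponentially unlikely that two given large sets can be
separated by a small open cut. -/
theorem exists_separation_rate {d : ℕ} (hd : 0 < d) {b ε q : ℝ} (hb : 0 < b) (hε : 0 < ε)
    (hq0 : 0 < q) (hq1 : q ≤ 1) :
    ∃ ρ c : ℝ, 0 < ρ ∧ 0 < c ∧
      ∀ (V : Type*) [Fintype V] [DecidableEq V] (G : SimpleGraph V) [DecidableRel G.Adj],
        (∀ v, G.degree v ≤ d) → IsExpander G b d → ∀ X Y : Finset V, Disjoint X Y →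
          ε * Fintype.card V ≤ X.card → ε * Fintype.card V ≤ Y.card →
            bernExp G.edgeFinset q (fun T => if ∃ W, X ⊆ W ∧ Disjoint W Y ∧
              ((cut T W).card : ℝ) ≤ ρ * Fintype.card V then 1 else 0)
              ≤ Real.exp (-c * Fintype.card V) := by
  have hd' : (0 : ℝ) < d := by exact_mod_cast hd
  -- Chosen so that `L * (b * ε * n) ≥ 2 * d * n`, twice the bound on the number of edges. This
  -- leaves `L ^ 2 * |K| ≥ d * n`, and `ρ * n` below is half of the resulting bound on the mean
  -- number of open connections.
  set L : ℕ := ⌈2 * d / (b * ε)⌉₊ with hL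
  have hL1 : 2 * d / (b * ε) ≤ L := Nat.le_ceil _
  have hL0 : (0 : ℝ) < L := lt_of_lt_of_le (by positivity) hL1
  have hL2 : 2 * d ≤ L * (b * ε) := by rwa [div_le_iff₀ (by positivity)] at hL1
  set ρ : ℝ := d / L ^ 2 * q ^ L / 2 with hρ
  have hρ0 : 0 < ρ := by positivity
  refine ⟨ρ, tailRate d 1 ρ, hρ0, tailRate_pos hd' one_pos hρ0, ?_⟩
  intro V _ _ G _ hdeg hG X Y hXY hX hY
  set n : ℝ := (Fintype.card V : ℝ)
  have hn : 0 ≤ n := Nat.cast_nonneg _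
  have hE := card_edgeFinset_le hdeg
  obtain ⟨K, hK, hdisj, hcard⟩ := exists_disjoint_crossings (E := G.edgeFinset) hXY
    (β := b * (ε * n)) (fun W hXW hWY => by
      have h1 : X.card ≤ W.card := Finset.card_le_card hXW
      have h2 : Y.card ≤ Wᶜ.card := Finset.card_le_card
        (Finset.subset_compl_iff_disjoint_left.2 hWY)
      exact hG.le_card_cut hb.le (hX.trans (by exact_mod_cast h1))
        (hY.trans (by exact_mod_cast h2))) L
  have hKn : d / L ^ 2 * n ≤ K.card := by
    rw [div_mul_eq_mul_div, div_le_iff₀ (by positivity)]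
    have h1 := mul_le_mul_of_nonneg_right hL2 hn
    nlinarith
  have hmean : 2 * ρ * n ≤ bernExp G.edgeFinset q (openCount K) := by
    refine le_trans ?_ (le_bernExp_openCount hq0.le hq1 fun P hP => ⟨(hK P hP).1, (hK P hP).2.1⟩)
    have := mul_le_mul_of_nonneg_right hKn (pow_pos hq0 L).le
    refine le_trans (le_of_eq ?_) this
    rw [hρ]
    ring
  refine le_trans ?_ (bernExp_lower_tail_linear hq0.le hq1 hd' one_pos hρ0 hn hE
    fun T _ e _ => abs_openCount_insert_sub_le hdisj T e)
  refine bernExp_mono hq0.le hq1 fun T _ => ?_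
  split_ifs with h1 h2 h2
  · exact le_rfl
  · obtain ⟨W, hXW, hWY, hW⟩ := h1
    have := openCount_le_card_cut hdisj (fun P hP => (hK P hP).2.2) hXW hWY T
    exact absurd (by linarith) h2
  · exact zero_le_one
  · exact le_rfl

theorem card_cut_le_of_cover {V : Type*} [Fintype V] [DecidableEq V] {G : SimpleGraph V}
    [DecidableRel G.Adj] {d : ℕ} (hd : ∀ v, G.degree v ≤ d) {F B' : Finset (Sym2 V)}
    {B : Finset V} (hF : F ⊆ G.edgeFinset) (hcov : ∀ e ∈ F, e ∈ B' ∨ ∃ v ∈ B, v ∈ e) :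
    F.card ≤ B'.card + B.card * d := by
  have hsub : F ⊆ B' ∪ B.biUnion fun v => G.incidenceFinset v := by
    intro e he
    rcases hcov e he with h | ⟨v, hv, hve⟩
    · exact Finset.mem_union_left _ h
    · refine Finset.mem_union_right _ (Finset.mem_biUnion.2 ⟨v, hv, ?_⟩)
      rw [SimpleGraph.mem_incidenceFinset]
      exact ⟨SimpleGraph.mem_edgeFinset.1 (hF he), hve⟩
  refine (Finset.card_le_card hsub).trans ((Finset.card_union_le _ _).trans ?_)
  refine Nat.add_le_add_left (Finset.card_biUnion_le_card_mul _ _ _ fun v _ => ?_) _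
  rw [SimpleGraph.card_incidenceFinset_eq_degree]
  exact hd v

open Classical in
/-- A set `W` with a small open cut can be rounded to a set respecting the fibres of a map `a`
which moves few vertices across `W`. -/
theorem exists_rounding {V : Type*} [Fintype V] [DecidableEq V] {G : SimpleGraph V}
    [DecidableRel G.Adj] {d D : ℕ} (hd : ∀ v, G.degree v ≤ d) {ε ρ η n : ℝ} (hn : 0 ≤ n)
    (hη1 : η * D ≤ ε / 2) (hη2 : η + η * D * d ≤ ρ) {T₁ T : Finset (Sym2 V)}
    (hT : T ⊆ G.edgeFinset) {M N W : Finset V} {a : V → V} (haN : ∀ v ∈ M, a v ∈ N)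
    (hB : ∀ B : Finset V, (∀ v ∈ B, v ∈ M ∧ ¬ (v ∈ W ↔ a v ∈ W)) →
        B.card ≤ (cut T₁ W).card * D)
    (hW1 : ε * n ≤ (W ∩ M).card) (hW2 : ε * n ≤ (M \ W).card)
    (hWc : ((cut (T₁ ∪ T) W).card : ℝ) ≤ η * n) :
    ∃ Z ∈ N.powerset, (ε / 2 * n ≤ (M.filter fun v => a v ∈ Z).card ∧
        ε / 2 * n ≤ (M \ M.filter fun v => a v ∈ Z).card) ∧
      ∃ W', (M.filter fun v => a v ∈ Z) ⊆ W' ∧ Disjoint W' (M \ M.filter fun v => a v ∈ Z) ∧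
        ((cut T W').card : ℝ) ≤ ρ * n := by
  set Z := N.filter fun v => v ∈ W with hZ
  refine ⟨Z, Finset.mem_powerset.2 (Finset.filter_subset _ _), ?_⟩
  set X := M.filter fun v => a v ∈ Z with hX
  set B := M.filter fun v => ¬ (v ∈ W ↔ a v ∈ W) with hBdef
  have hmemX : ∀ v, v ∈ X ↔ v ∈ M ∧ a v ∈ W := by
    intro v
    simp only [hX, hZ, Finset.mem_filter]
    exact and_congr_right fun hv => and_iff_right (haN v hv)
  have hBcard : (B.card : ℝ) ≤ η * D * n := by
    have h1 : B.card ≤ (cut T₁ W).card * D :=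
      hB B fun v hv => Finset.mem_filter.1 hv
    have h2 : ((cut T₁ W).card : ℝ) ≤ η * n := le_trans
      (Nat.cast_le.2 (Finset.card_le_card (cut_mono Finset.subset_union_left W))) hWc
    calc (B.card : ℝ) ≤ (cut T₁ W).card * D := by exact_mod_cast h1
      _ ≤ η * n * D := mul_le_mul_of_nonneg_right h2 (by positivity)
      _ = _ := by ring
  have hBε : (B.card : ℝ) ≤ ε / 2 * n := hBcard.trans (mul_le_mul_of_nonneg_right hη1 hn)
  -- The rounded set differs from `W` only on the displaced vertices `B`, so each edge of its cut
  -- lies in the cut of `W` or touches `B`.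
  refine ⟨⟨?_, ?_⟩, (W ∪ X) \ (M \ X), ?_, Finset.sdiff_disjoint, ?_⟩
  · have hsub : W ∩ M ⊆ X ∪ B := by
      intro v hv
      obtain ⟨hvW, hvM⟩ := Finset.mem_inter.1 hv
      by_cases h : a v ∈ W
      · exact Finset.mem_union_left _ ((hmemX v).2 ⟨hvM, h⟩)
      · exact Finset.mem_union_right _ (Finset.mem_filter.2 ⟨hvM, by simp [hvW, h]⟩)
    have h1 : ((W ∩ M).card : ℝ) ≤ (X).card + B.card := by
      exact_mod_cast (Finset.card_le_card hsub).trans (Finset.card_union_le _ _)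
    linarith
  · have hsub : M \ W ⊆ (M \ X) ∪ B := by
      intro v hv
      obtain ⟨hvM, hvW⟩ := Finset.mem_sdiff.1 hv
      by_cases h : a v ∈ W
      · exact Finset.mem_union_right _ (Finset.mem_filter.2 ⟨hvM, by simp [hvW, h]⟩)
      · exact Finset.mem_union_left _ (Finset.mem_sdiff.2 ⟨hvM, fun h' => h ((hmemX v).1 h').2⟩)
    have h1 : ((M \ W).card : ℝ) ≤ (M \ X).card + B.card := by
      exact_mod_cast (Finset.card_le_card hsub).trans (Finset.card_union_le _ _)
    linarith
  · intro v hv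
    exact Finset.mem_sdiff.2 ⟨Finset.mem_union_right _ hv, fun h => (Finset.mem_sdiff.1 h).2 hv⟩
  · have hle := card_cut_le_of_cover hd (F := cut T ((W ∪ X) \ (M \ X)))
      (B' := cut (T₁ ∪ T) W) (B := B) (fun e he => hT (mem_cut.1 he).1) (by
        intro e he
        obtain ⟨heT, x, hx, y, hy, rfl⟩ := mem_cut.1 he
        obtain ⟨hx1, hx2⟩ := Finset.mem_sdiff.1 hx
        by_cases hxW : x ∈ W
        · by_cases hyW : y ∈ W
          · right
            refine ⟨y, ?_, by simp⟩
            have hyY : y ∈ M \ X := by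
              by_contra h
              exact hy (Finset.mem_sdiff.2 ⟨Finset.mem_union_left _ hyW, h⟩)
            obtain ⟨hyM, hyX⟩ := Finset.mem_sdiff.1 hyY
            refine Finset.mem_filter.2 ⟨hyM, ?_⟩
            have : a y ∉ W := fun h => hyX ((hmemX y).2 ⟨hyM, h⟩)
            simp [hyW, this]
          · exact Or.inl (mem_cut.2 ⟨Finset.mem_union_right _ heT, x, hxW, y, hyW, rfl⟩)
        · right
          refine ⟨x, ?_, by simp⟩
          have hxX : x ∈ X := (Finset.mem_union.1 hx1).resolve_left hxW
          obtain ⟨hxM, hxa⟩ := (hmemX x).1 hxX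
          exact Finset.mem_filter.2 ⟨hxM, by simp [hxW, hxa]⟩)
    have hle' : ((cut T ((W ∪ X) \ (M \ X))).card : ℝ) ≤
        (cut (T₁ ∪ T) W).card + B.card * d := by exact_mod_cast hle
    have h1 := mul_le_mul_of_nonneg_right hBcard (Nat.cast_nonneg (α := ℝ) d)
    have h2 := mul_le_mul_of_nonneg_right hη2 hn
    linarith

open Classical in
/-- After sprinkling, it is exponentially unlikely that a small open cut splits the set `M` of
vertices in large clusters into two large parts. -/
theorem sprinkling_bound {V : Type*} [Fintype V] [DecidableEq V] {G : SimpleGraph V}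
    [DecidableRel G.Adj] {d m : ℕ} (hd : ∀ v, G.degree v ≤ d) {ε ρ c q η : ℝ}
    (hq0 : 0 ≤ q) (hq1 : q ≤ 1) (hη1 : η * (2 * (d + 1) ^ (2 * m)) ≤ ε / 2)
    (hη2 : η + η * (2 * (d + 1) ^ (2 * m)) * d ≤ ρ)
    (hsep : ∀ X Y : Finset V, Disjoint X Y →
          ε / 2 * Fintype.card V ≤ X.card → ε / 2 * Fintype.card V ≤ Y.card →
            bernExp G.edgeFinset q (fun T => if ∃ W, X ⊆ W ∧ Disjoint W Y ∧
              ((cut T W).card : ℝ) ≤ ρ * Fintype.card V then 1 else 0)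
              ≤ Real.exp (-c * Fintype.card V))
    {T₁ : Finset (Sym2 V)} (hT₁ : T₁ ⊆ G.edgeFinset) {M : Finset V}
    (hM : ∀ v ∈ M,
      m + 1 ≤ (walkBall (SimpleGraph.fromEdgeSet (T₁ : Set (Sym2 V))) v m).card) :
    bernExp G.edgeFinset q (fun T => if ∃ W : Finset V,
        ε * Fintype.card V ≤ (W ∩ M).card ∧ ε * Fintype.card V ≤ (M \ W).card ∧
        ((cut (T₁ ∪ T) W).card : ℝ) ≤ η * Fintype.card V then 1 else 0)
      ≤ Real.exp ((1 / (m + 1) - c) * Fintype.card V) := by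
  have hT₁' : (T₁ : Set (Sym2 V)) ⊆ G.edgeSet := fun e he =>
    SimpleGraph.mem_edgeFinset.1 (hT₁ (by exact_mod_cast he))
  -- The net depends only on `T₁`, which is fixed here, so the union bound over subsets of `N`
  -- concerns the sprinkled edges alone.
  obtain ⟨N, a, hN, haN, hB⟩ := exists_net hd hT₁' hM
  have hn : (0 : ℝ) ≤ Fintype.card V := Nat.cast_nonneg _
  have hNn : (N.card : ℝ) ≤ 1 / (m + 1) * Fintype.card V := by
    rw [div_mul_eq_mul_div, one_mul, le_div_iff₀ (by positivity)]
    exact_mod_cast hN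
  obtain ⟨A, hAdef⟩ : ∃ A : Finset V → Finset (Sym2 V) → Prop, ∀ Z T, A Z T ↔
      (ε / 2 * Fintype.card V ≤ (M.filter fun v => a v ∈ Z).card ∧
        ε / 2 * Fintype.card V ≤ (M \ M.filter fun v => a v ∈ Z).card) ∧
      ∃ W, (M.filter fun v => a v ∈ Z) ⊆ W ∧ Disjoint W (M \ M.filter fun v => a v ∈ Z) ∧
        ((cut T W).card : ℝ) ≤ ρ * Fintype.card V := ⟨_, fun _ _ => Iff.rfl⟩
  have hA : ∀ Z, bernExp G.edgeFinset q (fun T => if A Z T then 1 else 0) ≤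
      Real.exp (-c * Fintype.card V) := by
    intro Z
    by_cases hZ : ε / 2 * Fintype.card V ≤ (M.filter fun v => a v ∈ Z).card ∧
        ε / 2 * Fintype.card V ≤ (M \ M.filter fun v => a v ∈ Z).card
    · refine le_trans (le_of_eq (bernExp_congr fun T _ => ?_))
        (hsep _ _ Finset.disjoint_sdiff hZ.1 hZ.2)
      exact if_congr ((hAdef Z T).trans (and_iff_right hZ)) rfl rfl
    · have : (fun T => if A Z T then (1 : ℝ) else 0) = fun _ => 0 := by
        funext T
        exact if_neg fun h => hZ ((hAdef Z T).1 h).1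
      rw [this, bernExp_const]
      exact (Real.exp_pos _).le
  calc _ ≤ bernExp G.edgeFinset q (fun T => if ∃ Z ∈ N.powerset, A Z T then 1 else 0) := by
        refine bernExp_mono hq0 hq1 fun T hT => ?_
        split_ifs with h1 h2
        · exact le_rfl
        · obtain ⟨W, hW1, hW2, hWc⟩ := h1
          obtain ⟨Z, hZN, hZ⟩ := exists_rounding (D := 2 * (d + 1) ^ (2 * m)) hd hn
            (by exact_mod_cast hη1) (by exact_mod_cast hη2) hT haN (hB W) hW1 hW2 hWc
          exact absurd ⟨Z, hZN, (hAdef Z T).2 hZ⟩ h2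
        · exact zero_le_one
        · exact le_rfl
    _ ≤ ∑ Z ∈ N.powerset, bernExp G.edgeFinset q (fun T => if A Z T then 1 else 0) :=
        bernExp_exists_le _ hq0 hq1 A
    _ ≤ ∑ Z ∈ N.powerset, Real.exp (-c * Fintype.card V) := Finset.sum_le_sum fun Z _ => hA Z
    _ = 2 ^ N.card * Real.exp (-c * Fintype.card V) := by
        rw [Finset.sum_const, Finset.card_powerset, nsmul_eq_mul]
        push_cast
        rfl
    _ ≤ Real.exp (N.card) * Real.exp (-c * Fintype.card V) := by
        refine mul_le_mul_of_nonneg_right ?_ (Real.exp_pos _).le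
        rw [← mul_one (N.card : ℝ), Real.exp_nat_mul]
        exact pow_le_pow_left₀ (by norm_num) (by have := Real.add_one_le_exp 1; linarith) _
    _ ≤ _ := by
        rw [← Real.exp_add]
        exact Real.exp_le_exp.2 (by linarith)

end Sprinkling

/-! ### Deterministic part: from cuts to separators -/

section Deterministic

/-- Items of weight at most `t` and total weight at least `t` contain a subfamily of weight between
`t` and `2 t`. -/
theorem exists_subset_sum_between {ι : Type*} {s : Finset ι} {w : ι → ℝ} {t : ℝ}
    (hw : ∀ i ∈ s, w i ≤ t) (hs : t ≤ ∑ i ∈ s, w i) (ht : 0 ≤ t) :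
    ∃ u ⊆ s, t ≤ ∑ i ∈ u, w i ∧ ∑ i ∈ u, w i ≤ 2 * t := by
  classical
  induction s using Finset.induction_on with
  | empty => exact ⟨∅, subset_rfl, hs, by simpa using ht⟩
  | insert i s hi ih =>
    by_cases h : t ≤ ∑ i ∈ s, w i
    · obtain ⟨u, hu, h1, h2⟩ := ih (fun j hj => hw j (by simp [hj])) h
      exact ⟨u, hu.trans (Finset.subset_insert _ _), h1, h2⟩
    · refine ⟨insert i s, subset_rfl, hs, ?_⟩
      rw [Finset.sum_insert hi]
      have := hw i (by simp)
      linarith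

variable {V : Type*} [Fintype V] [DecidableEq V]

open Classical in
/-- If every small cut leaves most of `M` on one side, some cluster contains a third of `M`. -/
theorem exists_component_of_no_empty_cut {T : Finset (Sym2 V)} {M : Finset V} {s : ℝ}
    (hs : s ≤ M.card / 3)
    (hgood : ∀ W : Finset V, s ≤ (W ∩ M).card → s ≤ (M \ W).card → (cut T W).Nonempty) :
    ∃ K : (SimpleGraph.fromEdgeSet (T : Set (Sym2 V))).ConnectedComponent,
      (M.card : ℝ) / 3 ≤ K.supp.ncard := by
  set H := SimpleGraph.fromEdgeSet (T : Set (Sym2 V)) with hH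
  by_contra! hcon
  set w : H.ConnectedComponent → ℝ := fun K => (M.filter fun v => H.connectedComponentMk v = K).card
  have hwK : ∀ K, w K ≤ K.supp.ncard := by
    intro K
    have : (M.filter fun v => H.connectedComponentMk v = K).card ≤ K.supp.ncard := by
      rw [← Set.ncard_coe_finset]
      refine Set.ncard_le_ncard (fun v hv => ?_) (Set.toFinite _)
      exact (Finset.mem_filter.1 (Finset.mem_coe.1 hv)).2
    exact Nat.cast_le.2 this
  have hfib : ∀ u : Finset H.ConnectedComponent,
      ∑ K ∈ u, w K = (M.filter fun v => H.connectedComponentMk v ∈ u).card := by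
    intro u
    have := Finset.card_eq_sum_card_fiberwise (f := H.connectedComponentMk) (t := u)
      (s := M.filter fun v => H.connectedComponentMk v ∈ u)
      (fun v hv => (Finset.mem_filter.1 hv).2)
    rw [this]
    push_cast
    refine Finset.sum_congr rfl fun K hK => ?_
    simp only [w]
    congr 2
    ext v
    simp only [Finset.mem_filter]
    constructor
    · rintro ⟨h1, h2⟩
      exact ⟨⟨h1, h2 ▸ hK⟩, h2⟩
    · rintro ⟨⟨h1, -⟩, h2⟩
      exact ⟨h1, h2⟩
  have htot : ∑ K ∈ M.image H.connectedComponentMk, w K = M.card := by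
    rw [hfib, Finset.filter_true_of_mem fun v hv => Finset.mem_image_of_mem _ hv]
  -- If every cluster were small, some union of clusters would hold between one and two thirds of
  -- `M`; no edge of `T` leaves such a union.
  obtain ⟨u, -, hu1, hu2⟩ := exists_subset_sum_between
    (s := M.image H.connectedComponentMk) (w := w) (t := M.card / 3)
    (fun K _ => (hwK K).trans (hcon K).le)
    (by rw [htot]; have : (0 : ℝ) ≤ M.card := Nat.cast_nonneg _; linarith) (by positivity)
  rw [hfib] at hu1 hu2
  set W : Finset V := Finset.univ.filter fun v => H.connectedComponentMk v ∈ u with hW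
  have hWM : W ∩ M = M.filter fun v => H.connectedComponentMk v ∈ u := by
    ext v
    simp [hW, and_comm]
  have hsum : ((M \ W).card : ℝ) + (W ∩ M).card = M.card := by
    rw [Finset.inter_comm]
    exact_mod_cast Finset.card_sdiff_add_card_inter M W
  obtain ⟨e, he⟩ := hgood W (by rw [hWM]; linarith) (by rw [hWM] at hsum; linarith)
  obtain ⟨heT, x, hx, y, hy, rfl⟩ := mem_cut.1 he
  have hxy : H.Adj x y := (SimpleGraph.fromEdgeSet_adj _).2
    ⟨by exact_mod_cast heT, by rintro rfl; exact hy hx⟩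
  have hc : H.connectedComponentMk x = H.connectedComponentMk y :=
    SimpleGraph.ConnectedComponent.sound hxy.reachable
  rw [hW, Finset.mem_filter] at hx hy
  exact hy ⟨Finset.mem_univ _, hc ▸ hx.2⟩

variable {G : SimpleGraph V} [DecidableRel G.Adj] {d m : ℕ}

/-- The cluster of a non-survivor lies in a ball of at most `(d + 1) ^ m` vertices. -/
theorem supp_subset_survivors (hd : ∀ v, G.degree v ≤ d)
    (hg : ((2 * (m + 1) : ℕ) : ℕ∞) < G.egirth) {T : Finset (Sym2 V)} (hT : T ⊆ G.edgeFinset)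
    {K : (SimpleGraph.fromEdgeSet (T : Set (Sym2 V))).ConnectedComponent}
    (hK : (d + 1) ^ m < K.supp.ncard) {v : V} (hv : v ∈ K.supp) : v ∈ survivors G T m := by
  by_contra hvS
  have hT' : (T : Set (Sym2 V)) ⊆ G.edgeSet := fun e he =>
    SimpleGraph.mem_edgeFinset.1 (hT (by exact_mod_cast he))
  have hsub : K.supp ⊆ (walkBall G v m : Set V) := fun w hw =>
    Finset.mem_coe.2 (reachable_subset_walkBall hg hT' hvS (K.reachable_of_mem_supp hv hw))
  have h1 := Set.ncard_le_ncard hsub (Set.toFinite _)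
  rw [Set.ncard_coe_finset] at h1
  have := card_walkBall_le hd v m
  omega

open Classical in
/-- If no small open cut splits the large clusters, the largest cluster has no small separator. -/
theorem no_separator_of_no_small_cut (hd : ∀ v, G.degree v ≤ d)
    (hg : ((2 * (m + 1) : ℕ) : ℕ∞) < G.egirth) {T : Finset (Sym2 V)} (hT : T ⊆ G.edgeFinset)
    {M : Finset V} (hM : M ⊆ survivors G T m) {s t r : ℝ}
    (hgood : ∀ W : Finset V, s ≤ (W ∩ M).card → s ≤ (M \ W).card → d * t < (cut T W).card)
    (ht : 0 ≤ t) (hr : ((survivors G T m).card : ℝ) - M.card ≤ r)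
    (hMs : s ≤ M.card / 9 - t - r) (hr0 : 0 ≤ r) (hMm : ((d + 1) ^ m : ℝ) < M.card / 3)
    (K : (SimpleGraph.fromEdgeSet (T : Set (Sym2 V))).ConnectedComponent)
    (hK : IsLargestComponent _ K) :
    ¬ ∃ S : Set K, IsSeparator K.toSimpleGraph S ∧ (S.ncard : ℝ) ≤ t := by
  rintro ⟨S, ⟨A, B, hABS, hAB, hAS, hBS, hadj, hA, hB⟩, hS⟩
  have hM0 : (0 : ℝ) ≤ M.card := Nat.cast_nonneg _
  have hdt : 0 ≤ d * t := by positivity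
  obtain ⟨K', hK'⟩ := exists_component_of_no_empty_cut (T := T) (M := M) (s := s) (by linarith)
    (fun W h1 h2 => by
      rw [← Finset.card_pos]
      exact_mod_cast hdt.trans_lt (hgood W h1 h2))
  have hKcard : (M.card : ℝ) / 3 ≤ K.supp.ncard := hK'.trans (by exact_mod_cast hK K')
  have hKbig : (d + 1) ^ m < K.supp.ncard := by exact_mod_cast hMm.trans_le hKcard
  have hKsurv : ∀ v : K, (v : V) ∈ survivors G T m := fun v =>
    supp_subset_survivors hd hg hT hKbig v.2
  have hcardK : Nat.card K = K.supp.ncard := rfl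
  rw [hcardK] at hA hB
  have htotal : A.ncard + B.ncard + S.ncard = K.supp.ncard := by
    rw [← Set.ncard_union_eq hAB (Set.toFinite _) (Set.toFinite _),
      ← Set.ncard_union_eq (Set.disjoint_union_left.2 ⟨hAS, hBS⟩) (Set.toFinite _)
        (Set.toFinite _), hABS, Set.ncard_univ, hcardK]
  have htotal' : (A.ncard : ℝ) + B.ncard + S.ncard = K.supp.ncard := by exact_mod_cast htotal
  set F : Set K → Finset V := fun Q => (Subtype.val '' Q : Set V).toFinset with hF
  have hmemF : ∀ (Q : Set K) (v : V), v ∈ F Q ↔ ∃ h : v ∈ K, (⟨v, h⟩ : K) ∈ Q := by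
    intro Q v
    simp [hF]
  have hFcard : ∀ Q : Set K, (F Q).card = Q.ncard := by
    intro Q
    rw [← Set.ncard_image_of_injective Q Subtype.val_injective, Set.ncard_eq_toFinset_card']
  -- The whole component consists of survivors of `T`, of which at most `r` lie outside `M`.
  have hFM : ∀ Q : Set K, (Q.ncard : ℝ) - r ≤ (F Q ∩ M).card := by
    intro Q
    have h1 : F Q ⊆ (F Q ∩ M) ∪ (survivors G T m \ M) := by
      intro v hv
      obtain ⟨hvK, -⟩ := (hmemF Q v).1 hv
      by_cases hvM : v ∈ M
      · exact Finset.mem_union_left _ (Finset.mem_inter.2 ⟨hv, hvM⟩)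
      · exact Finset.mem_union_right _ (Finset.mem_sdiff.2 ⟨hKsurv ⟨v, hvK⟩, hvM⟩)
    have h2 : ((F Q).card : ℝ) ≤ (F Q ∩ M).card + (survivors G T m \ M).card := by
      exact_mod_cast (Finset.card_le_card h1).trans (Finset.card_union_le _ _)
    have h3 : ((survivors G T m \ M).card : ℝ) = (survivors G T m).card - M.card := by
      have := Finset.card_sdiff_add_card_eq_card hM
      rw [eq_sub_iff_add_eq]
      exact_mod_cast this
    rw [hFcard] at h2
    linarith
  have h1 := hFM A
  have h2 := hFM B
  have hBA : F B ∩ M ⊆ M \ F A := by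
    intro v hv
    obtain ⟨hvB, hvM⟩ := Finset.mem_inter.1 hv
    refine Finset.mem_sdiff.2 ⟨hvM, fun hvA => ?_⟩
    obtain ⟨h, hvB⟩ := (hmemF B v).1 hvB
    obtain ⟨h', hvA⟩ := (hmemF A v).1 hvA
    exact Set.disjoint_left.1 hAB hvA hvB
  have hBA' : ((F B ∩ M).card : ℝ) ≤ (M \ F A).card := by
    exact_mod_cast Finset.card_le_card hBA
  -- Each side has at least `|K| / 3 - t ≥ |M| / 9 - t` vertices, because the other has at most `2
  -- |K| / 3`; at most `r` of them are lost on passing to `M`.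
  have hlarge := hgood (F A) (by linarith) (by linarith)
  -- An open edge leaving `A` stays in the component and cannot end in `B`, so it ends in `S`.
  have hcover := card_cut_le_of_cover hd (F := cut T (F A)) (B' := ∅) (B := F S)
    (fun e he => hT (mem_cut.1 he).1) (by
      intro e he
      right
      obtain ⟨heT, x, hx, y, hy, rfl⟩ := mem_cut.1 he
      refine ⟨y, ?_, by simp⟩
      obtain ⟨hxK, hxA⟩ := (hmemF A x).1 hx
      have hxy : (SimpleGraph.fromEdgeSet (T : Set (Sym2 V))).Adj x y :=
        (SimpleGraph.fromEdgeSet_adj _).2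
          ⟨by exact_mod_cast heT, by rintro rfl; exact hy hx⟩
      have hyK : y ∈ K := K.mem_supp_of_adj_mem_supp hxK hxy
      have hyABS : (⟨y, hyK⟩ : K) ∈ A ∪ B ∪ S := by rw [hABS]; trivial
      rcases hyABS with (h | h) | h
      · exact absurd ((hmemF A y).2 ⟨hyK, h⟩) hy
      · exact absurd hxy (hadj _ hxA _ h)
      · exact (hmemF S y).2 ⟨hyK, h⟩)
  rw [Finset.card_empty, zero_add, hFcard] at hcover
  have hcover' : ((cut T (F A)).card : ℝ) ≤ S.ncard * d := by exact_mod_cast hcover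
  have h3 := mul_le_mul_of_nonneg_right hS (Nat.cast_nonneg (α := ℝ) d)
  linarith

end Deterministic

/-! ### Assembling the probability estimate -/

/-- No largest component of `H` has a separator of size at most `t`. -/
def NoSmallSeparator {V : Type*} (t : ℝ) (H : SimpleGraph V) : Prop :=
  ∀ K : H.ConnectedComponent, IsLargestComponent H K →
    ¬ ∃ S : Set K, IsSeparator K.toSimpleGraph S ∧ (S.ncard : ℝ) ≤ t

section Probability

variable {V : Type*} [Fintype V] [DecidableEq V] {G : SimpleGraph V} [DecidableRel G.Adj]
  {d k : ℕ} {θ ρ c η δ p p₁ q : ℝ}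

open Classical in
-- The three error events are: too many survivors at density `p`, too few at density `p₁`, and a
-- small cut splitting the `p₁`-survivors after sprinkling.
theorem bernExp_small_separator_le (hd0 : 0 < d) (hd : G.IsRegularOfDegree d)
    (hg : ((2 * (k + 1 + 1) : ℕ) : ℕ∞) < G.egirth)
    (hp₁0 : 0 ≤ p₁) (hp₁1 : p₁ ≤ 1) (hq0 : 0 ≤ q) (hq1 : q ≤ 1) (hp0 : 0 ≤ p) (hp1 : p ≤ 1)
    (hpq : 1 - p = (1 - p₁) * (1 - q)) (hθ : 0 < θ)
    (hroot₁ : (1 - 1 / 100) * θ ≤ rootProb d p₁ k) (hroot : rootProb d p k ≤ (1 + 1 / 100) * θ)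
    (hδ0 : 0 ≤ δ) (hδη : d * δ ≤ η) (hδθ : δ ≤ θ / 100)
    (hη1 : η * (2 * (d + 1) ^ (2 * (k + 1))) ≤ θ / 20 / 2)
    (hη2 : η + η * (2 * (d + 1) ^ (2 * (k + 1))) * d ≤ ρ)
    (hsep : ∀ X Y : Finset V, Disjoint X Y →
          θ / 20 / 2 * Fintype.card V ≤ X.card → θ / 20 / 2 * Fintype.card V ≤ Y.card →
            bernExp G.edgeFinset q (fun T => if ∃ W, X ⊆ W ∧ Disjoint W Y ∧
              ((cut T W).card : ℝ) ≤ ρ * Fintype.card V then 1 else 0)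
              ≤ Real.exp (-c * Fintype.card V))
    (hbig : ((d + 1) ^ (k + 1) : ℝ) < θ / 4 * Fintype.card V) :
    bernExp G.edgeFinset p (fun T => if ¬ NoSmallSeparator (δ * Fintype.card V)
        (SimpleGraph.fromEdgeSet (T : Set (Sym2 V))) then 1 else 0) ≤
      2 * Real.exp (-tailRate d (2 * (d + 1) ^ (k + 1)) (θ / 100) * Fintype.card V) +
        Real.exp ((1 / ((k + 1 : ℕ) + 1) - c) * Fintype.card V) := by
  have hdeg : ∀ v, G.degree v ≤ d := fun v => (hd v).le
  have hd' : (0 : ℝ) < d := by exact_mod_cast hd0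
  have hn : (0 : ℝ) ≤ Fintype.card V := Nat.cast_nonneg _
  have hE := card_edgeFinset_le hdeg
  set f : Finset (Sym2 V) → ℝ := fun T => ((survivors G T (k + 1)).card : ℝ) with hf
  have hmean : ∀ x, bernExp G.edgeFinset x f = Fintype.card V * rootProb d x k :=
    bernExp_card_survivors hd hg
  have hdiff : ∀ T ⊆ G.edgeFinset, ∀ e ∈ G.edgeFinset, |f (insert e T) - f T| ≤
      2 * (d + 1) ^ (k + 1) := fun T _ e _ => abs_card_survivors_insert_sub_le hdeg T e
  have hup := bernExp_upper_tail_linear hp0 hp1 hd' (c := 2 * ((d : ℝ) + 1) ^ (k + 1))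
    (by positivity) (show 0 < θ / 100 by positivity) hn hE hdiff
  have hlow := bernExp_lower_tail_linear hp₁0 hp₁1 hd' (c := 2 * ((d : ℝ) + 1) ^ (k + 1))
    (by positivity) (show 0 < θ / 100 by positivity) hn hE hdiff
  set e₁ := Real.exp (-tailRate d (2 * (d + 1) ^ (k + 1)) (θ / 100) * Fintype.card V)
  set e₂ := Real.exp ((1 / ((k + 1 : ℕ) + 1) - c) * Fintype.card V)
  -- The upper tail at density `p` is removed before decomposing into `T₁ ∪ T`, so that it is
  -- estimated for the union itself.
  obtain ⟨Q, hQ⟩ : ∃ Q : Finset (Sym2 V) → Prop, ∀ T, Q T ↔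
    (¬ NoSmallSeparator (δ * Fintype.card V) (SimpleGraph.fromEdgeSet (T : Set (Sym2 V))) ∧
      f T < bernExp G.edgeFinset p f + θ / 100 * Fintype.card V) := ⟨_, fun _ => Iff.rfl⟩
  have hcond : ∀ T₁ ⊆ G.edgeFinset,
      bernExp G.edgeFinset q (fun T => if Q (T₁ ∪ T) then 1 else 0) ≤
        (if f T₁ ≤ bernExp G.edgeFinset p₁ f - θ / 100 * Fintype.card V then 1 else 0) + e₂ := by
    intro T₁ hT₁
    split_ifs with hsmall
    · have h1 : bernExp G.edgeFinset q (fun T => if Q (T₁ ∪ T) then 1 else 0) ≤ 1 := by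
        refine (bernExp_mono hq0 hq1 (g := fun _ => 1) fun T _ => ?_).trans
          (bernExp_const _ _ _).le
        split_ifs <;> norm_num
      have := (Real.exp_pos ((1 / ((k + 1 : ℕ) + 1) - c) * Fintype.card V)).le
      linarith
    · rw [zero_add]
      push Not at hsmall
      refine le_trans (bernExp_mono hq0 hq1 fun T hT => ?_) (sprinkling_bound hdeg hq0 hq1 hη1 hη2
        hsep hT₁ (M := survivors G T₁ (k + 1)) fun v hv => card_walkBall_of_mem_survivors hv)
      split_ifs with h1 h2 h2
      · exact le_rfl
      · exfalso
        obtain ⟨hns, hfT⟩ := (hQ _).1 h1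
        rw [hmean] at hsmall hfT
        have hb1 := mul_le_mul_of_nonneg_left hroot₁ hn
        have hb2 := mul_le_mul_of_nonneg_left hroot hn
        have hδn := mul_le_mul_of_nonneg_right hδθ hn
        have hδηn := mul_le_mul_of_nonneg_right hδη hn
        have hθn : 0 ≤ θ * Fintype.card V := mul_nonneg hθ.le hn
        -- Here `|M| ≥ 0.98 θ n` and the survivors of the union number at most `1.02 θ n`, whence `r
        -- = 0.04 θ n`. The level `s = θ n / 20` works since `0.98 / 9 - 0.01 - 0.04 > 0.05`.
        refine hns fun K hK => no_separator_of_no_small_cut (m := k + 1) hdeg hg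
          (Finset.union_subset hT₁ hT) (survivors_mono Finset.subset_union_left)
          (s := θ / 20 * Fintype.card V) (r := 4 / 100 * θ * Fintype.card V) ?_ (by positivity)
          ?_ ?_ (by positivity) ?_ K hK
        · intro W hW1 hW2
          by_contra! hW
          exact h2 ⟨W, hW1, hW2, by linarith⟩
        · simp only [hf] at hsmall hfT
          linarith
        · simp only [hf] at hsmall hfT
          linarith
        · simp only [hf] at hsmall hfT
          linarith
      · exact zero_le_one
      · exact le_rfl
  have hsprinkle : bernExp G.edgeFinset p (fun T => if Q T then 1 else 0) ≤ e₁ + e₂ := by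
    rw [bernExp_union _ p₁ q p hpq]
    refine (bernExp_mono hp₁0 hp₁1 hcond).trans ?_
    rw [bernExp_add, bernExp_const]
    linarith
  calc _ ≤ bernExp G.edgeFinset p (fun T =>
          (if bernExp G.edgeFinset p f + θ / 100 * Fintype.card V ≤ f T then 1 else 0) +
            if Q T then 1 else 0) := by
        refine bernExp_mono hp0 hp1 fun T _ => ?_
        by_cases h1 : bernExp G.edgeFinset p f + θ / 100 * Fintype.card V ≤ f T
        · rw [if_pos h1]
          split_ifs <;> norm_num
        · rw [if_neg h1]
          by_cases h2 : NoSmallSeparator (δ * Fintype.card V)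
              (SimpleGraph.fromEdgeSet (T : Set (Sym2 V)))
          · rw [if_neg (not_not.2 h2)]
            split_ifs <;> norm_num
          · rw [if_pos h2, if_pos ((hQ T).2 ⟨h2, not_le.1 h1⟩)]
            norm_num
    _ ≤ e₁ + (e₁ + e₂) := by
        rw [bernExp_add]
        exact add_le_add hup hsprinkle
    _ = _ := by ring

open Classical in
theorem percolation_real_ge {p : unitInterval} {S : SimpleGraph V → Prop} {x : ℝ}
    (h : bernExp G.edgeFinset (p : ℝ) (fun T =>
      if ¬ S (SimpleGraph.fromEdgeSet (T : Set (Sym2 V))) then 1 else 0) ≤ x) :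
    1 - x ≤ (percolation G p).real {H | S H} := by
  rw [percolation_real_eq_bernExp]
  have h1 : bernExp G.edgeFinset (p : ℝ) (fun T =>
      if ¬ S (SimpleGraph.fromEdgeSet (T : Set (Sym2 V))) then 1 else 0) =
      1 - bernExp G.edgeFinset (p : ℝ) (fun T =>
        if SimpleGraph.fromEdgeSet (T : Set (Sym2 V)) ∈ {H | S H} then 1 else 0) := by
    rw [← bernExp_one_sub]
    refine bernExp_congr fun T _ => ?_
    by_cases hS : S (SimpleGraph.fromEdgeSet (T : Set (Sym2 V)))
    · simp [hS]
    · simp [hS]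
  rw [h1] at h
  linarith

end Probability

end PercExp

theorem theorem4p1 (d : ℕ) (hd : 3 ≤ d) (p : unitInterval)
    (hp : 1 / ((d : ℝ) - 1) < (p : ℝ)) (hp1 : (p : ℝ) < 1) (b : ℝ) (hb : 0 < b) :
    ∃ (δ c₁ : ℝ) (R : ℕ) (C : ℝ), 0 < δ ∧ 0 < c₁ ∧ 0 < R ∧ 0 < C ∧
      ∀ (V : Type*) [Fintype V] [DecidableEq V] (G : SimpleGraph V) [DecidableRel G.Adj],
        G.IsRegularOfDegree d → PercExp.IsExpander G b d → (R : ℕ∞) < G.egirth →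
          1 - C * Real.exp (-c₁ * (Fintype.card V : ℝ)) ≤
            (PercExp.percolation G p).real
              {H : SimpleGraph V | ∀ K : H.ConnectedComponent, PercExp.IsLargestComponent H K →
                ¬ ∃ S : Set K, PercExp.IsSeparator K.toSimpleGraph S ∧
                  (S.ncard : ℝ) ≤ δ * (Fintype.card V : ℝ)} := by
  have hd0 : 0 < d := by omega
  have hd' : (0 : ℝ) < d := by exact_mod_cast hd0
  have hp0 : (0 : ℝ) ≤ p := p.2.1
  obtain ⟨θ, p₁, hθ, hp₁0, hp₁p, hroot₁, n₀, hroot⟩ :=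
    PercExp.exists_smaller_parameter hd hp hp1.le (κ := 1 / 100) (by norm_num)
  have hp₁1 : 0 < 1 - p₁ := by linarith
  -- The solution of `1 - p = (1 - p₁) * (1 - q)`.
  set q : ℝ := (p - p₁) / (1 - p₁) with hq
  have hq0 : 0 < q := div_pos (by linarith) hp₁1
  have hq1 : q ≤ 1 := by rw [hq, div_le_one hp₁1]; linarith
  have hpq : 1 - (p : ℝ) = (1 - p₁) * (1 - q) := by
    rw [hq]
    field_simp
    ring
  obtain ⟨ρ, c, hρ, hc, hsep⟩ :=
    PercExp.exists_separation_rate hd0 hb (show 0 < θ / 20 / 2 by positivity) hq0 hq1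
  -- The depth is `m = k + 1`, chosen after `c`, so that the entropy `1 / (m + 1)` of the net is at
  -- most `c / 2`.
  obtain ⟨k, hkn, hkc⟩ : ∃ k : ℕ, n₀ ≤ k ∧ 2 / c ≤ k :=
    ⟨max n₀ ⌈2 / c⌉₊, le_max_left _ _, (Nat.le_ceil _).trans (by exact_mod_cast le_max_right _ _)⟩
  have hkc' : 1 / (((k + 1 : ℕ) : ℝ) + 1) ≤ c / 2 := by
    rw [div_le_iff₀ hc] at hkc
    rw [div_le_div_iff₀ (by positivity) (by norm_num)]
    push_cast
    nlinarith
  set D : ℝ := 2 * ((d : ℝ) + 1) ^ (2 * (k + 1)) with hD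
  have hD0 : 0 < D := by positivity
  set η : ℝ := min (θ / 20 / 2 / D) (ρ / (1 + D * d)) with hη
  have hη0 : 0 < η := by positivity
  have hη1 : η * D ≤ θ / 20 / 2 := by
    rw [← le_div_iff₀ hD0]
    exact min_le_left _ _
  have hη2 : η + η * D * d ≤ ρ := by
    have : η * (1 + D * d) ≤ ρ := by
      rw [← le_div_iff₀ (by positivity)]
      exact min_le_right _ _
    linarith
  set δ : ℝ := min (θ / 100) (η / d) with hδ
  have hδ0 : 0 < δ := by positivity
  have hδη : d * δ ≤ η := by
    rw [mul_comm, ← le_div_iff₀ hd']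
    exact min_le_right _ _
  set r : ℝ := PercExp.tailRate d (2 * (d + 1) ^ (k + 1)) (θ / 100) with hr
  have hr0 : 0 < r := PercExp.tailRate_pos hd' (by positivity) (by positivity)
  set c₁ : ℝ := min r (c / 2) with hc₁
  have hc₁0 : 0 < c₁ := by positivity
  set n₁ : ℝ := ((d : ℝ) + 1) ^ (k + 1) / (θ / 4) with hn₁
  -- The girth bound is `2 * (m + 1)`. In `C`, the `3` covers the three exponential errors, and `exp
  -- (c₁ * n₁)` makes the claim trivial for at most `n₁` vertices.
  refine ⟨δ, c₁, 2 * (k + 1 + 1), 3 + Real.exp (c₁ * n₁), hδ0, hc₁0, by omega, by positivity, ?_⟩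
  intro V _ _ G _ hreg hexp hg
  have hn : (0 : ℝ) ≤ Fintype.card V := Nat.cast_nonneg _
  rcases le_or_gt (Fintype.card V : ℝ) n₁ with hsmall | hlarge
  · have h1 : 1 ≤ Real.exp (c₁ * n₁) * Real.exp (-c₁ * Fintype.card V) := by
      rw [← Real.exp_add, Real.one_le_exp_iff]
      have := mul_le_mul_of_nonneg_left hsmall hc₁0.le
      linarith
    have h2 : 0 < Real.exp (-c₁ * Fintype.card V) := Real.exp_pos _
    have h3 : 0 ≤ (PercExp.percolation G p).real
              {H : SimpleGraph V | ∀ K : H.ConnectedComponent, PercExp.IsLargestComponent H K →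
                ¬ ∃ S : Set K, PercExp.IsSeparator K.toSimpleGraph S ∧
                  (S.ncard : ℝ) ≤ δ * (Fintype.card V : ℝ)} := measureReal_nonneg
    linarith
  · have hbig : (((d : ℝ) + 1) ^ (k + 1) : ℝ) < θ / 4 * Fintype.card V := by
      rw [hn₁, div_lt_iff₀ (by positivity)] at hlarge
      linarith
    have hbound := PercExp.bernExp_small_separator_le (G := G) hd0 hreg hg hp₁0.le (by linarith)
      hq0.le hq1 hp0 hp1.le hpq hθ (hroot₁ k) (hroot k hkn) hδ0.le hδη (min_le_left _ _) hη1 hη2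
      (hsep V G (fun v => (hreg v).le) hexp) hbig
    refine PercExp.percolation_real_ge (S := PercExp.NoSmallSeparator (δ * Fintype.card V))
      (hbound.trans ?_)
    have h1 : Real.exp (-r * Fintype.card V) ≤ Real.exp (-c₁ * Fintype.card V) := by
      refine Real.exp_le_exp.2 ?_
      have := mul_le_mul_of_nonneg_right (min_le_left r (c / 2)) hn
      linarith
    have h2 : Real.exp ((1 / (((k + 1 : ℕ) : ℝ) + 1) - c) * Fintype.card V) ≤
        Real.exp (-c₁ * Fintype.card V) := by
      refine Real.exp_le_exp.2 (mul_le_mul_of_nonneg_right ?_ hn)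
      have := min_le_right r (c / 2)
      linarith
    have h3 : 0 < Real.exp (c₁ * n₁) * Real.exp (-c₁ * Fintype.card V) := by positivity
    linarith
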